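/- Let $\mathbb F_q$ be a finite field, $\Theta$ an automorphism of $\mathbb F_q$, $\mathcal R=\mathbb F_q+u\mathbb F_q$ with $u^2=u$, $\theta(a+ub)=\Theta(a)+u\Theta(b)$, and let $\mathbb F_q[x;\Theta]$ be the skew polynomial ring with $(ax^i)(bx^j)=a\Theta^i(b)x^{i+j}$. Let $\alpha,\beta\ge 0$ be integers, not both $0$, with $|\langle\theta\rangle|$ dividing $\beta$ and $\gcd(\alpha,|\langle\Theta\rangle|)=1$. Let $M\in GL_2(\mathbb F_q)$ satisfy $MM^T=\gamma I_2$ with $\gamma\in\mathbb F_q^*$, and let $\varphi:\mathbb F_q^\alpha\times\mathcal R^\beta\to\mathbb F_q^{\alpha+2\beta}$ be the Gray map $$\varphi(a_0,\dots,a_{\alpha-1},r_0,\dots,r_{\beta-1})=(a_0,\dots,a_{\alpha-1},(r_{0,1},r_{0,2})M,\dots,(r_{\beta-1,1},r_{\beta-1,2})M),\qquad r_j=(1-u)r_{j,1}+u\,r_{j,2},\ r_{j,i}\in\mathbb F_q .$$ Let $\mathcal C'=\langle f(x)\rangle\subseteq\mathbb F_q[x]/\langle x^\alpha-1\rangle$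 be a cyclic code of length $\alpha$ over $\mathbb F_q$, with $x^\alpha-1=h(x)f(x)$ in $\mathbb F_q[x]$. Let $\mathscr C$ be a skew cyclic code of length $\beta$ over $\mathcal R$, that is, an $\mathcal R$-submodule of $\mathcal R^\beta$ closed under $(c_0,\dots,c_{\beta-1})\mapsto(\theta(c_{\beta-1}),\theta(c_0),\dots,\theta(c_{\beta-2}))$. Write $\mathscr C=(1-u)\,\mathcal C_1\oplus u\,\mathcal C_2$ with $\mathcal C_1,\mathcal C_2\subseteq\mathbb F_q^\beta$, and suppose that, for $i=1,2$, $\mathcal C_i=\langle g_i(x)\rangle$ is the left $\mathbb F_q[x;\Theta]$-submodule of $\mathbb F_q[x;\Theta]/\langle x^\beta-1\rangle$ generated by $g_i(x)$, where $x^\beta-1=h_i(x)g_i(x)$ in $\mathbb F_q[x;\Theta]$. Let $\mathcal C=\mathcal C'\otimes\mathscr C=\{(c',c)\mid c'\in\mathcal C',\ c\in\mathscr C\}$, let $k=\dim_{\mathbb F_q}\varphi(\mathcal C)$, and let $d_H$ be the minimum Hamming distance of $\varphi(\mathcal C)$. For $p(x)=p_0+\dots+p_sx^s$ of degree $s$ put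 $p^*(x)=p_s+p_{s-1}x+\dots+p_0x^s$ and $p^\dagger(x)=p_s+\Theta(p_{s-1})x+\dots+\Theta^s(p_0)x^s$. If $f(x)f^*(x)$ divides $x^\alpha-1$ in $\mathbb F_q[x]$, and if, for $i=1,2$, $h_i^\dagger(x)h_i(x)=a_i(x)(x^\beta-1)$ for some $a_i(x)\in\mathbb F_q[x;\Theta]$, then $2k\ge\alpha+2\beta$ and there exists a quantum code $[[\alpha+2\beta,\,2k-(\alpha+2\beta),\,d_H]]_q$. Here an $[[n,\kappa,d]]_q$ quantum code is a $q^\kappa$-dimensional subspace $Q$ of $(\mathbb C^q)^{\otimes n}$ with minimum distance $d$: every operator acting on fewer than $d$ tensor factors is detected by $Q$, and some operator acting on $d$ tensor factors is not, where $E$ is detected if $PEP=cP$ for a scalar $c$, $P$ being the orthogonal projection onto $Q$; for $\kappa=0$, by the usual purity convention, $c$ is required to be $q^{-n}\operatorname{tr}E$. -/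

import Mathlib

open scoped Matrix

noncomputable section

namespace SkewQuantum

/-! ### The ring `R = F + uF` with `u ^ 2 = u` -/

/-- `F[u] / (u ^ 2 - u)`. The element `a + u b` is `⟨a, b⟩`. -/
abbrev RRing (F : Type*) [Field F] : Type _ := QuadraticAlgebra F 0 1

/-- The automorphism `θ (a + u b) = Θ a + u Θ b` of `R`, for an automorphism `Θ` of `F`. -/
def thetaR {F : Type*} [Field F] (Θ : RingAut F) : RingAut (RRing F) where
  toFun r := ⟨Θ r.re, Θ r.im⟩
  invFun r := ⟨Θ.symm r.re, Θ.symm r.im⟩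
  left_inv r := by ext <;> simp
  right_inv r := by ext <;> simp
  map_mul' r s := by ext <;> simp
  map_add' r s := by ext <;> simp

/-! ### Skew polynomials -/

/-- A copy of `F`, carrying the action of `ℕ` (written multiplicatively) by powers of `Θ`. -/
def Twisted {F : Type*} [Field F] (_Θ : RingAut F) : Type _ := F

instance {F : Type*} [Field F] (Θ : RingAut F) : Field (Twisted Θ) :=
  inferInstanceAs (Field F)

/-- The `n`-th power of `x` acts on coefficients as `Θ ^ n`. -/
instance {F : Type*} [Field F] (Θ : RingAut F) :
    MulSemiringAction (Multiplicative ℕ) (Twisted Θ) :=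
  MulSemiringAction.compHom F (powersHom (RingAut F) Θ)

/-- The skew polynomial ring `F[x; Θ]`, in which `(a x ^ i) (b x ^ j) = a Θ^i(b) x ^ (i + j)`. -/
abbrev SkewPoly {F : Type*} [Field F] (Θ : RingAut F) : Type _ := SkewPolynomial (Twisted Θ)

/-- The degree of a skew polynomial (`0` for the zero polynomial). -/
def skewDegree {F : Type*} [Field F] {Θ : RingAut F} (h : SkewPoly Θ) : ℕ :=
  (SkewPolynomial.support h).sup id

/-- `h† = h_k + Θ(h_{k-1}) x + ⋯ + Θ^k(h_0) x ^ k`, for `h = h_0 + h_1 x + ⋯ + h_k x ^ k`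
of degree `k`. -/
def dagger {F : Type*} [Field F] {Θ : RingAut F} (h : SkewPoly Θ) : SkewPoly Θ :=
  ∑ i ∈ Finset.range (skewDegree h + 1),
    SkewPolynomial.monomial i ((Θ ^ i : RingAut F) (SkewPolynomial.coeff h (skewDegree h - i)))

/-- The skew polynomial `x ^ n - 1`. -/
def xPowSubOne {F : Type*} [Field F] (Θ : RingAut F) (n : ℕ) : SkewPoly Θ :=
  SkewPolynomial.X ^ n - 1

/-- `d` divides `p` from the right. -/
def RightDvd {A : Type*} [Mul A] (d p : A) : Prop := ∃ a, p = a * d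

/-! ### Codes -/

/-- A set of words over `A` is closed under the skew cyclic shift
`(c_0, …, c_{n-1}) ↦ (σ c_{n-1}, σ c_0, …, σ c_{n-2})`. -/
def IsSkewCyclic {A : Type*} [CommRing A] (σ : RingAut A) {n : ℕ}
    (C : Submodule A (Fin n → A)) : Prop :=
  ∀ c ∈ C, (fun i => σ (c ((finRotate n).symm i))) ∈ C

/-- A cyclic code over `A`: no twist. -/
def IsCyclicCode {A : Type*} [CommRing A] {n : ℕ} (C : Submodule A (Fin n → A)) : Prop :=
  IsSkewCyclic 1 C

/-- `C = ⟨f⟩` as a cyclic code: identifying the word `c` with the class of `∑ c_i x ^ i`,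
`C` is the ideal of `F[x] / (x ^ n - 1)` generated by the class of `f`. -/
def IsGeneratedBy {F : Type*} [Field F] {n : ℕ} (C : Submodule F (Fin n → F))
    (f : Polynomial F) : Prop :=
  ∀ c : Fin n → F, c ∈ C ↔
    Ideal.Quotient.mk (Ideal.span {(Polynomial.X ^ n - 1 : Polynomial F)})
        (∑ i : Fin n, Polynomial.monomial (i : ℕ) (c i)) ∈
      Ideal.span {Ideal.Quotient.mk (Ideal.span {(Polynomial.X ^ n - 1 : Polynomial F)}) f}

/-- `C = ⟨g⟩` as a skew cyclic code: identifying the word `c` with the class of `∑ c_i x ^ i`,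
`C` is the left `F[x; Θ]`-submodule of `F[x; Θ] / ⟨x ^ n - 1⟩` generated by the class of `g`. -/
def IsSkewGeneratedBy {F : Type*} [Field F] (Θ : RingAut F) {n : ℕ}
    (C : Submodule F (Fin n → F)) (g : SkewPoly Θ) : Prop :=
  ∀ c : Fin n → F, c ∈ C ↔
    (Submodule.span (SkewPoly Θ) {xPowSubOne Θ n}).mkQ
        (∑ i : Fin n, SkewPolynomial.monomial (i : ℕ) (show Twisted Θ from c i)) ∈
      Submodule.span (SkewPoly Θ) {(Submodule.span (SkewPoly Θ) {xPowSubOne Θ n}).mkQ g}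

/-- `C₁ = {a | a + u b ∈ C for some b}`, for a linear code `C` over `R`. -/
def component₁ {F : Type*} [Field F] {n : ℕ} (C : Submodule (RRing F) (Fin n → RRing F)) :
    Submodule F (Fin n → F) where
  carrier := {v | ∃ c ∈ C, v = fun i => (c i).re}
  zero_mem' := ⟨0, C.zero_mem, rfl⟩
  add_mem' := by
    rintro _ _ ⟨c, hc, rfl⟩ ⟨d, hd, rfl⟩
    exact ⟨c + d, C.add_mem hc hd, rfl⟩
  smul_mem' := by
    rintro t _ ⟨c, hc, rfl⟩
    exact ⟨t • c, C.smul_of_tower_mem t hc, rfl⟩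

/-- `C₂ = {a + b | a + u b ∈ C}`, for a linear code `C` over `R`. -/
def component₂ {F : Type*} [Field F] {n : ℕ} (C : Submodule (RRing F) (Fin n → RRing F)) :
    Submodule F (Fin n → F) where
  carrier := {v | ∃ c ∈ C, v = fun i => (c i).re + (c i).im}
  zero_mem' := ⟨0, C.zero_mem, by ext; simp⟩
  add_mem' := by
    rintro _ _ ⟨c, hc, rfl⟩ ⟨d, hd, rfl⟩
    exact ⟨c + d, C.add_mem hc hd, by ext; simp; ring⟩
  smul_mem' := by
    rintro t _ ⟨c, hc, rfl⟩
    exact ⟨t • c, C.smul_of_tower_mem t hc, by ext; simp [mul_add]⟩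

/-- The Gray map `F^α × R^β → F^(α + 2β)`,
`(a, r) ↦ (a_0, …, a_{α-1}, (r_{0,1}, r_{0,2}) M, …, (r_{β-1,1}, r_{β-1,2}) M)`, where
`r_j = (1 - u) r_{j,1} + u r_{j,2}`, that is, `r_{j,1} = a` and `r_{j,2} = a + b` for
`r_j = a + u b`. The `α + 2β` coordinates are indexed by `Fin α ⊕ Fin β × Fin 2`. -/
def grayMap {F : Type*} [Field F] (M : Matrix (Fin 2) (Fin 2) F) (α β : ℕ) :
    ((Fin α → F) × (Fin β → RRing F)) →ₗ[F] (Fin α ⊕ Fin β × Fin 2 → F) where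
  toFun c := Sum.elim c.1
    fun js => (![(c.2 js.1).re, (c.2 js.1).re + (c.2 js.1).im] ᵥ* M) js.2
  map_add' c d := by
    ext (i | js)
    · simp
    · simp [Matrix.vecMul, dotProduct, Fin.sum_univ_two]; ring
  map_smul' t c := by
    ext (i | js)
    · simp
    · simp [Matrix.vecMul, dotProduct, Fin.sum_univ_two]; ring

/-- The direct product `C' ⊗ D = {(a, r) | a ∈ C', r ∈ D}` inside `F^α × R^β`. -/
def mixedProd {F : Type*} [Field F] {α β : ℕ} (C' : Submodule F (Fin α → F))
    (D : Submodule (RRing F) (Fin β → RRing F)) :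
    Submodule F ((Fin α → F) × (Fin β → RRing F)) :=
  C'.prod (D.restrictScalars F)

/-- The minimum Hamming distance of a linear code. -/
def minHammingDist {F : Type*} [Field F] [DecidableEq F] {ι : Type*} [Fintype ι]
    (C : Submodule F (ι → F)) : ℕ :=
  sInf {d | ∃ c ∈ C, ∃ c' ∈ C, c ≠ c' ∧ hammingDist c c' = d}

/-! ### Quantum codes -/

/-- The Hilbert space `(ℂ^q)^{⊗ n}`: the basis vector indexed by `x` is
`|x_0⟩ ⊗ ⋯ ⊗ |x_{n-1}⟩`. -/
abbrev QuditSpace (q n : ℕ) : Type := EuclideanSpace ℂ (Fin n → Fin q)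

/-- The operator `E` on `(ℂ^q)^{⊗ n}` (as a matrix in the product basis) has the form
`e ⊗ identity`, with `e` acting on the tensor factors in `S`. -/
def ActsOn {q n : ℕ} (S : Finset (Fin n)) (E : Matrix (Fin n → Fin q) (Fin n → Fin q) ℂ) : Prop :=
  ∃ e : Matrix (S → Fin q) (S → Fin q) ℂ, ∀ x y : Fin n → Fin q,
    ((∀ i ∉ S, x i = y i) → E x y = e (fun i => x i) (fun i => y i)) ∧
    (¬ (∀ i ∉ S, x i = y i) → E x y = 0)

/-- The code space `Q` detects the error `E`: with `P` the orthogonal projection onto `Q`, one has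
`P E P = c P` for a scalar `c`. As usual, a one-dimensional code (for which this is void) is
required to be pure: there `c` has to be the normalized trace of `E`. -/
def Detects {q n : ℕ} (Q : Submodule ℂ (QuditSpace q n))
    (E : Matrix (Fin n → Fin q) (Fin n → Fin q) ℂ) : Prop :=
  ∃ c : ℂ, (∀ v ∈ Q, ∀ w ∈ Q, inner ℂ v (Matrix.toEuclideanLin E w) = c * inner ℂ v w) ∧
    (Module.finrank ℂ Q = 1 → c = E.trace / (q : ℂ) ^ n)

/-- `Q` is an `[[n, k, d]]_q` quantum code: a `q ^ k`-dimensional subspace of `(ℂ^q)^{⊗ n}` with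
minimum distance `d`, i.e. every error on fewer than `d` tensor factors is detected and some
error on `d` tensor factors is not. -/
def IsQuantumCode (q n k d : ℕ) (Q : Submodule ℂ (QuditSpace q n)) : Prop :=
  Module.finrank ℂ Q = q ^ k ∧
  (∀ S : Finset (Fin n), S.card < d → ∀ E, ActsOn S E → Detects Q E) ∧
  (∃ S : Finset (Fin n), S.card = d ∧ ∃ E, ActsOn S E ∧ ¬ Detects Q E)

end SkewQuantum

end

noncomputable section

namespace SkewQuantum

/-! ### Operators acting on a set of coordinates, and pairs of codes -/

/-! Write n = α + 2β and let C be the Gray image. The proof shows that C contains its Euclidean dual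
C^⊥, and then applies the CSS construction to the pair C^⊥ ≤ C, which encodes k - (n - k) = 2k - n
qudits.

Dual containment. Since M Mᵀ = γ I, the Gray map turns the dot product into the sum of the form on
F^α and γ times the forms on the two components of the R-part, so it suffices that each of C', C₁,
C₂ contains its dual (`dualCode_map_grayMap_le`). For a code generated by g with h g = x^n - 1 (n
now its own length), the shifts of the (twisted) reciprocal of h span the dual by a dimension count,
and the divisibility hypothesis makes this reciprocal a multiple of g
(`dualCode_le_of_isSkewGeneratedBy`, `dualCode_le_of_isGeneratedBy`).

Quantum code. For V ≤ W take the span of the uniform superpositions of the cosets of V in W. An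
error on the coordinates S satisfies the Knill-Laflamme condition once every word of W supported in
S lies in V, and V and W have the same restrictions to S (`IsLocalKernel.sum_sum_eq`); the second
condition dualizes to one on words of V^⊥ supported in S.

Exact distance. The code of C^⊥ < C has distance the minimum weight of C \ C^⊥, which may exceed
d_H. As only existence is claimed, the pair is deformed by coordinate shears, which keep both
dimensions and lower the distance one unit at a time (`IsCSSPair.exists_pred`). If C = C^⊥, the
purity convention makes the distance equal to d_H directly. -/

/-- Otherwise a linear functional separates the restriction of x to S from the restrictions of V;
composed with the restriction it is the dot product with a word z supported in S. -/
theorem exists_mem_eqOn_of_dual {ι F : Type*} [Fintype ι] [DecidableEq ι] [Field F]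
    {S : Finset ι} {V W : Submodule F (ι → F)}
    (h : ∀ z : ι → F, (∀ v ∈ V, z ⬝ᵥ v = 0) → (∀ i ∉ S, z i = 0) → ∀ w ∈ W, z ⬝ᵥ w = 0) :
    ∀ x ∈ W, ∃ v ∈ V, ∀ i ∈ S, v i = x i := by
  intro x hx
  by_contra hcon
  set π : (ι → F) →ₗ[F] (ι → F) := LinearMap.pi fun i => if i ∈ S then LinearMap.proj i else 0
    with hπ
  have hπa : ∀ y i, π y i = if i ∈ S then y i else 0 := by
    intro y i
    rw [hπ, LinearMap.pi_apply]
    split <;> simp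
  have hxV : π x ∉ V.map π := by
    rintro ⟨v, hv, hvx⟩
    refine hcon ⟨v, hv, fun i hi => ?_⟩
    simpa [hπa, hi] using congrFun hvx i
  obtain ⟨f, hfx, hfV⟩ := Submodule.exists_le_ker_of_notMem hxV
  have hz : ∀ y, (fun i => f (π (Pi.single i 1))) ⬝ᵥ y = f (π y) := by
    intro y
    have := LinearMap.pi_apply_eq_sum_univ (f ∘ₗ π) y
    simp only [LinearMap.comp_apply] at this
    rw [this, dotProduct]
    refine Finset.sum_congr rfl fun i _ => ?_
    rw [smul_eq_mul, mul_comm]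
    congr 3
    ext j
    simp [Pi.single_apply, eq_comm]
  refine hfx ?_
  rw [← hz]
  refine h _ (fun v hv => ?_) (fun i hi => ?_) x hx
  · rw [hz]; exact hfV ⟨v, hv, rfl⟩
  · have : π (Pi.single i 1) = 0 := by
      ext j
      rw [hπa]
      by_cases hj : j ∈ S
      · have : j ≠ i := fun h => hi (h ▸ hj)
        simp [this]
      · simp [hj]
    simp [this]

/-! ### The Knill-Laflamme condition by averaging over V -/

section Averaging

variable {ι F : Type*} [Fintype ι] [DecidableEq ι] [Field F] [Fintype F]

open scoped Classical

/-- A kernel `E` on words of the form `e ⊗ identity`, with `e` acting on the coordinates in `S`. -/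
structure IsLocalKernel (S : Finset ι) (E : (ι → F) → (ι → F) → ℂ) : Prop where
  eq_zero : ∀ x y, ¬ (∀ i ∉ S, x i = y i) → E x y = 0
  congr : ∀ x y x' y', (∀ i ∈ S, x i = x' i) → (∀ i ∈ S, y i = y' i) →
    (∀ i ∉ S, x i = y i) → (∀ i ∉ S, x' i = y' i) → E x y = E x' y'

/-- The sum of the entries `E x (x + s)` over the codewords `s`. -/
def rowSum (V : Submodule F (ι → F)) (E : (ι → F) → (ι → F) → ℂ) (x : ι → F) : ℂ :=
  ∑ s : V, E x (x + s)

variable {S : Finset ι} {E : (ι → F) → (ι → F) → ℂ} {V W : Submodule F (ι → F)}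

/-- Only the s supported in S contribute, and for those the entry sees x only through its
restriction to S. -/
theorem IsLocalKernel.rowSum_congr (hE : IsLocalKernel S E) {x x' : ι → F}
    (h : ∀ i ∈ S, x i = x' i) : rowSum V E x = rowSum V E x' := by
  refine Finset.sum_congr rfl fun s _ => ?_
  by_cases hs : ∀ i ∉ S, (s : ι → F) i = 0
  · exact hE.congr _ _ _ _ h (fun i hi => by simp [h i hi]) (fun i hi => by simp [hs i hi])
      (fun i hi => by simp [hs i hi])
  · rw [hE.eq_zero, hE.eq_zero]
    · exact fun h' => hs fun i hi => by simpa using h' i hi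
    · exact fun h' => hs fun i hi => by simpa using h' i hi

theorem IsLocalKernel.sum_rowSum_add (hE : IsLocalKernel S E) {x : ι → F}
    (h : ∃ v ∈ V, ∀ i ∈ S, v i = x i) :
    ∑ v : V, rowSum V E (x + v) = ∑ v : V, rowSum V E v := by
  obtain ⟨w, hw, hwx⟩ := h
  rw [← Equiv.sum_comp (Equiv.addLeft (⟨w, hw⟩ : V)) (fun v : V => rowSum V E v)]
  refine Finset.sum_congr rfl fun v _ => hE.rowSum_congr fun i hi => ?_
  simp [hwx i hi]

/-- With y = x + s, locality forces s to be supported in S and φ forces s ∈ W. Hence s ∈ V, and φ is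
constant along s. -/
theorem IsLocalKernel.sum_eq_rowSum_mul (hE : IsLocalKernel S E)
    (hWV : ∀ x ∈ W, (∀ i ∉ S, x i = 0) → x ∈ V) {φ : (ι → F) → ℂ} (hφ : ∀ x ∉ W, φ x = 0)
    (hφV : ∀ x, ∀ v ∈ V, φ (x + v) = φ x) {x : ι → F} (hx : x ∈ W) :
    ∑ y, E x y * φ y = rowSum V E x * φ x := by
  rw [← Equiv.sum_comp (Equiv.addLeft x), rowSum, Finset.sum_mul,
    ← Finset.sum_subset (Finset.subset_univ (Finset.univ.filter (· ∈ V))),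
    Finset.sum_subtype (p := (· ∈ V)) _ (by simp)]
  · exact Finset.sum_congr rfl fun s _ => by simp [hφV x s s.2]
  · intro s _ hs
    have hs : s ∉ V := by simpa using hs
    by_cases h : ∀ i ∉ S, s i = 0
    · rw [Equiv.coe_addLeft, hφ, mul_zero]
      exact fun h' => hs (hWV s (by simpa using W.sub_mem h' hx) h)
    · rw [Equiv.coe_addLeft, hE.eq_zero, zero_mul]
      exact fun h' => h fun i hi => by simpa using h' i hi

/-- The Knill-Laflamme condition. On W the kernel acts as multiplication by its row sum. Since ψφ is
V-invariant, the row sum may be averaged over the coset x + V, and this average is the same for all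
x ∈ W because x agrees on S with a word of V. -/
theorem IsLocalKernel.sum_sum_eq (hE : IsLocalKernel S E)
    (hWV : ∀ x ∈ W, (∀ i ∉ S, x i = 0) → x ∈ V) (hVW : ∀ x ∈ W, ∃ v ∈ V, ∀ i ∈ S, v i = x i)
    {φ ψ : (ι → F) → ℂ} (hφ : ∀ x ∉ W, φ x = 0) (hφV : ∀ x, ∀ v ∈ V, φ (x + v) = φ x)
    (hψ : ∀ x ∉ W, ψ x = 0) (hψV : ∀ x, ∀ v ∈ V, ψ (x + v) = ψ x) :
    ∑ x, ψ x * ∑ y, E x y * φ y =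
      ((∑ v : V, rowSum V E v) / Fintype.card V) * ∑ x, ψ x * φ x := by
  have h1 : ∀ x, ψ x * ∑ y, E x y * φ y = ψ x * φ x * rowSum V E x := by
    intro x
    by_cases hx : x ∈ W
    · rw [hE.sum_eq_rowSum_mul hWV hφ hφV hx]; ring
    · simp [hψ x hx]
  have h2 : ∀ v : V, ∑ x, ψ x * φ x * rowSum V E x = ∑ x, ψ x * φ x * rowSum V E (x + v) := by
    intro v
    rw [← Equiv.sum_comp (Equiv.addRight (v : ι → F))]
    exact Finset.sum_congr rfl fun x _ => by simp [hφV x v v.2, hψV x v v.2]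
  have h3 : (Fintype.card V : ℂ) * ∑ x, ψ x * φ x * rowSum V E x =
      (∑ v : V, rowSum V E v) * ∑ x, ψ x * φ x := by
    rw [← nsmul_eq_mul, ← Finset.card_univ, ← Finset.sum_const,
      Finset.sum_congr rfl fun v _ => h2 v, Finset.sum_comm, Finset.mul_sum]
    refine Finset.sum_congr rfl fun x _ => ?_
    rw [← Finset.mul_sum]
    by_cases hx : x ∈ W
    · rw [hE.sum_rowSum_add (hVW x hx), mul_comm]
    · simp [hφ x hx]
  have hc : (Fintype.card V : ℂ) ≠ 0 := Nat.cast_ne_zero.mpr Fintype.card_ne_zero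
  rw [Finset.sum_congr rfl fun x _ => h1 x]
  field_simp
  rw [mul_comm]
  exact h3

/-- The purity condition. The row sum reduces to the diagonal entry, as no nonzero word of V lives
on S, and its average over any translate of V is the same, so it equals the average over all words.
-/
theorem IsLocalKernel.average_eq_trace (hE : IsLocalKernel S E)
    (hV : ∀ x ∈ V, (∀ i ∉ S, x i = 0) → x = 0) (hVS : ∀ x : ι → F, ∃ v ∈ V, ∀ i ∈ S, v i = x i) :
    (∑ v : V, rowSum V E v) / Fintype.card V =
      (∑ x, E x x) / (Fintype.card F : ℂ) ^ Fintype.card ι := by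
  have h1 : ∀ x, rowSum V E x = E x x := by
    intro x
    rw [rowSum, Finset.sum_eq_single 0 _ (by simp)]
    · simp
    · intro s _ hs
      refine hE.eq_zero _ _ fun h => hs (Subtype.ext (hV s s.2 fun i hi => ?_))
      simpa using h i hi
  have h2 : ∀ v : V, ∑ x, rowSum V E (x + v) = ∑ x, E x x := fun v =>
    (Equiv.sum_comp (Equiv.addRight (v : ι → F)) (fun x => rowSum V E x)).trans
      (Finset.sum_congr rfl fun x _ => h1 x)
  have h3 : (Fintype.card V : ℂ) * ∑ x, E x x =
      (Fintype.card F : ℂ) ^ Fintype.card ι * ∑ v : V, rowSum V E v := by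
    have := Finset.sum_comm (s := Finset.univ) (t := Finset.univ)
      (f := fun (x : ι → F) (v : V) => rowSum V E (x + v))
    rw [Finset.sum_congr rfl fun x _ => hE.sum_rowSum_add (hVS x),
      Finset.sum_congr rfl fun v _ => h2 v] at this
    simpa using this.symm
  have hc : (Fintype.card V : ℂ) ≠ 0 := Nat.cast_ne_zero.mpr Fintype.card_ne_zero
  have hF : (Fintype.card F : ℂ) ≠ 0 := Nat.cast_ne_zero.mpr Fintype.card_ne_zero
  rw [div_eq_div_iff hc (pow_ne_zero _ hF), mul_comm, ← h3, mul_comm]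

end Averaging

/-! ### The quantum code of a nested pair of codes -/

section CSS

variable {F : Type*} [Fintype F] {n : ℕ}

/-- The identification of basis labels with words over `F`. -/
def labelEquiv (F : Type*) [Fintype F] (n : ℕ) :
    (Fin n → Fin (Fintype.card F)) ≃ (Fin n → F) :=
  Equiv.arrowCongr (Equiv.refl _) (Fintype.equivFin F).symm

theorem labelEquiv_apply (x : Fin n → Fin (Fintype.card F)) (i : Fin n) :
    labelEquiv F n x i = (Fintype.equivFin F).symm (x i) := rfl

theorem labelEquiv_eq_iff (x y : Fin n → Fin (Fintype.card F)) (i : Fin n) :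
    labelEquiv F n x i = labelEquiv F n y i ↔ x i = y i := by
  simp [labelEquiv_apply]

/-- A matrix on the qudit space, as a kernel on words. -/
def wordKernel (E : Matrix (Fin n → Fin (Fintype.card F)) (Fin n → Fin (Fintype.card F)) ℂ)
    (x y : Fin n → F) : ℂ :=
  E ((labelEquiv F n).symm x) ((labelEquiv F n).symm y)

theorem inner_eq_sum_words (v w : QuditSpace (Fintype.card F) n) :
    inner ℂ v w = ∑ x : Fin n → F, star (v ((labelEquiv F n).symm x)) *
      w ((labelEquiv F n).symm x) := by
  rw [PiLp.inner_apply, ← Equiv.sum_comp (labelEquiv F n).symm]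
  exact Finset.sum_congr rfl fun x _ => by simp [mul_comm]

theorem toEuclideanLin_apply_word
    (E : Matrix (Fin n → Fin (Fintype.card F)) (Fin n → Fin (Fintype.card F)) ℂ)
    (w : QuditSpace (Fintype.card F) n) (x : Fin n → F) :
    Matrix.toEuclideanLin E w ((labelEquiv F n).symm x) =
      ∑ y, wordKernel E x y * w ((labelEquiv F n).symm y) := by
  rw [Matrix.toLpLin_apply]
  simp only [Matrix.mulVec, dotProduct]
  rw [← Equiv.sum_comp (labelEquiv F n).symm]
  rfl

theorem isLocalKernel_wordKernel {S : Finset (Fin n)}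
    {E : Matrix (Fin n → Fin (Fintype.card F)) (Fin n → Fin (Fintype.card F)) ℂ}
    (hE : ActsOn S E) : IsLocalKernel S (wordKernel (F := F) E) := by
  obtain ⟨e, he⟩ := hE
  have key : ∀ (x y : Fin n → F) i, (labelEquiv F n).symm x i = (labelEquiv F n).symm y i ↔
      x i = y i := fun x y i => by rw [← labelEquiv_eq_iff (F := F)]; simp
  constructor
  · intro x y h
    exact (he _ _).2 (by simpa only [key] using h)
  · intro x y x' y' h1 h2 h3 h4
    rw [wordKernel, wordKernel, (he _ _).1 (by simpa only [key] using h3),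
      (he _ _).1 (by simpa only [key] using h4)]
    congr 1 <;> ext i : 1
    · exact (key _ _ _).2 (h1 i i.2)
    · exact (key _ _ _).2 (h2 i i.2)

variable [Field F]

open scoped Classical in
/-- A function on `W / V`, seen as a state supported on `W` and invariant under `V`. -/
def cosetState (V W : Submodule F (Fin n → F)) :
    ((W ⧸ V.submoduleOf W) → ℂ) →ₗ[ℂ] QuditSpace (Fintype.card F) n where
  toFun g := WithLp.toLp 2 fun x =>
    if h : labelEquiv F n x ∈ W then g (Submodule.Quotient.mk ⟨labelEquiv F n x, h⟩) else 0
  map_add' f g := by ext x; by_cases h : labelEquiv F n x ∈ W <;> simp [h]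
  map_smul' t g := by ext x; by_cases h : labelEquiv F n x ∈ W <;> simp [h]

/-- The quantum code of the pair `V ≤ W`, spanned by the uniform superpositions of the cosets of
`V` in `W`. -/
def cosetCode (V W : Submodule F (Fin n → F)) : Submodule ℂ (QuditSpace (Fintype.card F) n) :=
  LinearMap.range (cosetState V W)

variable {V W : Submodule F (Fin n → F)}

theorem cosetState_apply_of_mem (g : (W ⧸ V.submoduleOf W) → ℂ) {x : Fin n → F} (h : x ∈ W) :
    cosetState V W g ((labelEquiv F n).symm x) = g (Submodule.Quotient.mk ⟨x, h⟩) := by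
  simp [cosetState, h]

theorem cosetState_apply_of_notMem (g : (W ⧸ V.submoduleOf W) → ℂ) {x : Fin n → F}
    (h : x ∉ W) : cosetState V W g ((labelEquiv F n).symm x) = 0 := by
  simp [cosetState, h]

theorem cosetState_injective : Function.Injective (cosetState V W) := by
  intro f g hfg
  ext c
  obtain ⟨⟨x, hx⟩, rfl⟩ := Submodule.Quotient.mk_surjective _ c
  rw [← cosetState_apply_of_mem f hx, hfg, cosetState_apply_of_mem g hx]

theorem finrank_cosetCode (hVW : V ≤ W) {κ : ℕ}
    (h : Module.finrank F W = Module.finrank F V + κ) :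
    Module.finrank ℂ (cosetCode V W) = Fintype.card F ^ κ := by
  classical
  have hfin : Finite (W ⧸ V.submoduleOf W) := inferInstance
  have := Fintype.ofFinite (W ⧸ V.submoduleOf W)
  rw [cosetCode, LinearMap.finrank_range_of_inj cosetState_injective,
    Module.finrank_fintype_fun_eq_card, Module.card_eq_pow_finrank (K := F)]
  congr 1
  have h1 := Submodule.finrank_quotient_add_finrank (V.submoduleOf W)
  have h2 := (Submodule.submoduleOfEquivOfLe hVW).finrank_eq
  omega

theorem eq_zero_of_mem_cosetCode {ψ : QuditSpace (Fintype.card F) n} (hψ : ψ ∈ cosetCode V W)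
    (x : Fin n → F) (hx : x ∉ W) : ψ ((labelEquiv F n).symm x) = 0 := by
  obtain ⟨g, rfl⟩ := hψ
  exact cosetState_apply_of_notMem g hx

theorem apply_add_of_mem_cosetCode (hVW : V ≤ W) {ψ : QuditSpace (Fintype.card F) n}
    (hψ : ψ ∈ cosetCode V W) (x v : Fin n → F) (hv : v ∈ V) :
    ψ ((labelEquiv F n).symm (x + v)) = ψ ((labelEquiv F n).symm x) := by
  by_cases hx : x ∈ W
  · obtain ⟨g, rfl⟩ := hψ
    rw [cosetState_apply_of_mem g hx, cosetState_apply_of_mem g (W.add_mem hx (hVW hv))]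
    congr 1
    rw [Submodule.Quotient.eq]
    simpa [Submodule.submoduleOf] using hv
  · rw [eq_zero_of_mem_cosetCode hψ x hx, eq_zero_of_mem_cosetCode hψ]
    exact fun h => hx (by simpa using W.sub_mem h (hVW hv))

open scoped Classical in
theorem inner_toEuclideanLin_of_mem_cosetCode (hVW : V ≤ W) {S : Finset (Fin n)}
    {E : Matrix (Fin n → Fin (Fintype.card F)) (Fin n → Fin (Fintype.card F)) ℂ}
    (hE : ActsOn S E) (hWV : ∀ x ∈ W, (∀ i ∉ S, x i = 0) → x ∈ V)
    (hS : ∀ x ∈ W, ∃ v ∈ V, ∀ i ∈ S, v i = x i) {v w : QuditSpace (Fintype.card F) n}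
    (hv : v ∈ cosetCode V W) (hw : w ∈ cosetCode V W) :
    inner ℂ v (Matrix.toEuclideanLin E w) =
      ((∑ s : V, rowSum V (wordKernel E) s) / Fintype.card V) * inner ℂ v w := by
  rw [inner_eq_sum_words (F := F), inner_eq_sum_words (F := F)]
  simp only [toEuclideanLin_apply_word]
  refine (isLocalKernel_wordKernel hE).sum_sum_eq hWV hS (eq_zero_of_mem_cosetCode hw)
    (apply_add_of_mem_cosetCode hVW hw) (fun x hx => ?_) (fun x u hu => ?_)
  · rw [eq_zero_of_mem_cosetCode hv x hx, star_zero]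
  · rw [apply_add_of_mem_cosetCode hVW hv x u hu]

theorem detects_cosetCode (hVW : V ≤ W) {S : Finset (Fin n)}
    {E : Matrix (Fin n → Fin (Fintype.card F)) (Fin n → Fin (Fintype.card F)) ℂ}
    (hE : ActsOn S E) (hWV : ∀ x ∈ W, (∀ i ∉ S, x i = 0) → x ∈ V)
    (hS : ∀ x ∈ W, ∃ v ∈ V, ∀ i ∈ S, v i = x i)
    (hrank : Module.finrank ℂ (cosetCode V W) ≠ 1) : Detects (cosetCode V W) E := by
  classical
  exact ⟨_, fun v hv w hw => inner_toEuclideanLin_of_mem_cosetCode hVW hE hWV hS hv hw,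
    fun h => absurd h hrank⟩

theorem detects_cosetCode_self {S : Finset (Fin n)}
    {E : Matrix (Fin n → Fin (Fintype.card F)) (Fin n → Fin (Fintype.card F)) ℂ}
    (hE : ActsOn S E) (hV : ∀ x ∈ V, (∀ i ∉ S, x i = 0) → x = 0)
    (hS : ∀ x : Fin n → F, ∃ v ∈ V, ∀ i ∈ S, v i = x i) : Detects (cosetCode V V) E := by
  classical
  refine ⟨_, fun v hv w hw => inner_toEuclideanLin_of_mem_cosetCode le_rfl hE (fun x hx _ => hx)
    (fun x _ => hS x) hv hw, fun _ => ?_⟩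
  rw [(isLocalKernel_wordKernel hE).average_eq_trace hV hS, Fintype.card_fin, Matrix.trace,
    ← Equiv.sum_comp (labelEquiv F n).symm]
  rfl

open scoped Classical in
/-- The shift by a word `w`. -/
def shiftMatrix (w : Fin n → F) :
    Matrix (Fin n → Fin (Fintype.card F)) (Fin n → Fin (Fintype.card F)) ℂ :=
  fun x y => if labelEquiv F n x = labelEquiv F n y + w then 1 else 0

theorem actsOn_shiftMatrix {w : Fin n → F} {S : Finset (Fin n)} (hw : ∀ i ∉ S, w i = 0) :
    ActsOn S (shiftMatrix w) := by
  classical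
  refine ⟨fun a b => if ∀ i, (Fintype.equivFin F).symm (a i) =
    (Fintype.equivFin F).symm (b i) + w i then 1 else 0, fun x y => ⟨fun h => ?_, fun h => ?_⟩⟩
  · refine if_congr ⟨fun h' i => congrFun h' i, fun h' => funext fun i => ?_⟩ rfl rfl
    by_cases hi : i ∈ S
    · exact h' ⟨i, hi⟩
    · simp [labelEquiv_apply, h i hi, hw i hi]
  · refine if_neg fun h' => h fun i hi => ?_
    rw [← labelEquiv_eq_iff (F := F), h', Pi.add_apply, hw i hi, add_zero]

theorem toEuclideanLin_shiftMatrix_apply (w x : Fin n → F)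
    (ψ : QuditSpace (Fintype.card F) n) :
    Matrix.toEuclideanLin (shiftMatrix w) ψ ((labelEquiv F n).symm x) =
      ψ ((labelEquiv F n).symm (x - w)) := by
  rw [toEuclideanLin_apply_word, Finset.sum_eq_single (x - w) _ (by simp)]
  · simp [wordKernel, shiftMatrix]
  · intro y _ hy
    simp only [wordKernel, shiftMatrix, Equiv.apply_symm_apply]
    rw [if_neg, zero_mul]
    exact fun h => hy (eq_sub_of_add_eq (by simpa using h.symm))

open scoped Classical in
/-- The unnormalized uniform superposition of the coset of `w`. -/
def cosetVector (V W : Submodule F (Fin n → F)) (w : W) : QuditSpace (Fintype.card F) n :=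
  cosetState V W (Pi.single (Submodule.Quotient.mk w) 1)

theorem cosetVector_mem (w : W) : cosetVector V W w ∈ cosetCode V W := ⟨_, rfl⟩

open scoped Classical in
theorem cosetVector_apply (hVW : V ≤ W) (w : W) (x : Fin n → F) :
    cosetVector V W w ((labelEquiv F n).symm x) = if x - w ∈ V then 1 else 0 := by
  by_cases hx : x ∈ W
  · rw [cosetVector, cosetState_apply_of_mem _ hx, Pi.single_apply]
    refine if_congr ?_ rfl rfl
    rw [Submodule.Quotient.eq]
    simp [Submodule.submoduleOf]
  · rw [cosetVector, cosetState_apply_of_notMem _ hx, if_neg]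
    exact fun h => hx (by simpa using W.add_mem (hVW h) w.2)

theorem toEuclideanLin_shiftMatrix_cosetVector (hVW : V ≤ W) (w : W) :
    Matrix.toEuclideanLin (shiftMatrix (w : Fin n → F)) (cosetVector V W 0) =
      cosetVector V W w := by
  ext x
  obtain ⟨x, rfl⟩ := (labelEquiv F n).symm.surjective x
  rw [toEuclideanLin_shiftMatrix_apply, cosetVector_apply hVW, cosetVector_apply hVW,
    Submodule.coe_zero, sub_zero]

theorem cosetVector_ne_zero (hVW : V ≤ W) (w : W) : cosetVector V W w ≠ 0 := by
  intro h
  have := congrArg (fun ψ : QuditSpace (Fintype.card F) n => ψ ((labelEquiv F n).symm w)) h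
  simp [cosetVector_apply hVW] at this

/-- The shift carries the state of the coset V to that of w + V. The two are orthogonal, so
detection would force the latter to have norm zero. -/
theorem not_detects_shiftMatrix (hVW : V ≤ W) (w : W) (hw : (w : Fin n → F) ∉ V) :
    ¬ Detects (cosetCode V W) (shiftMatrix (w : Fin n → F)) := by
  rintro ⟨c, hc, -⟩
  have h := hc _ (cosetVector_mem w) _ (cosetVector_mem 0)
  rw [toEuclideanLin_shiftMatrix_cosetVector hVW] at h
  have h0 : inner ℂ (cosetVector V W w) (cosetVector V W 0) = 0 := by
    rw [inner_eq_sum_words (F := F)]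
    refine Finset.sum_eq_zero fun x _ => ?_
    rw [cosetVector_apply hVW, cosetVector_apply hVW]
    by_cases hx : x ∈ V
    · have : x - w ∉ V := fun h => hw (by simpa using V.sub_mem hx h)
      simp [this]
    · simp [hx]
  rw [h0, mul_zero] at h
  exact cosetVector_ne_zero hVW w (inner_self_eq_zero.mp h)

/-- The shift fixes the single code state, so c would be 1, whereas purity requires c = 0, a
nontrivial shift having zero trace. -/
theorem not_detects_shiftMatrix_self (hrank : Module.finrank ℂ (cosetCode V V) = 1) (w : V)
    (hw : (w : Fin n → F) ≠ 0) : ¬ Detects (cosetCode V V) (shiftMatrix (w : Fin n → F)) := by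
  rintro ⟨c, hc, htr⟩
  have h := hc _ (cosetVector_mem 0) _ (cosetVector_mem 0)
  have hw0 : cosetVector V V w = cosetVector V V 0 := by
    rw [cosetVector, cosetVector]
    congr 2
    rw [Submodule.Quotient.eq]
    simp [Submodule.submoduleOf]
  have htr0 : (shiftMatrix (w : Fin n → F)).trace = 0 :=
    Finset.sum_eq_zero fun x _ => if_neg (by simpa using hw)
  rw [toEuclideanLin_shiftMatrix_cosetVector le_rfl, hw0, htr hrank, htr0, zero_div,
    zero_mul] at h
  exact cosetVector_ne_zero le_rfl (0 : V) (inner_self_eq_zero.mp h)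

end CSS

/-! ### Minimum distance of a CSS pair, and lowering it -/

section Distance

variable {F : Type*} [Field F] {n : ℕ}

/-- Adding `t` times the coordinate `j` to the coordinate `i`. -/
def addCoord {i j : Fin n} (hij : i ≠ j) (t : F) : (Fin n → F) ≃ₗ[F] (Fin n → F) where
  toFun x := x + Pi.single i (t * x j)
  invFun x := x + Pi.single i (-t * x j)
  map_add' x y := by rw [Pi.add_apply, mul_add, Pi.single_add]; abel
  map_smul' c x := by
    rw [Pi.smul_apply, smul_eq_mul, mul_left_comm, ← smul_eq_mul, Pi.single_smul, ← smul_add]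
    rfl
  left_inv x := by ext k; by_cases hk : k = i <;> simp [hij.symm, hk]
  right_inv x := by ext k; by_cases hk : k = i <;> simp [hij.symm, hk]

/-- The transpose of a shear is a shear, so duals are controlled as well as the codes. -/
theorem dotProduct_addCoord {i j : Fin n} (hij : i ≠ j) (t : F) (z x : Fin n → F) :
    z ⬝ᵥ addCoord hij t x = (z + Pi.single j (t * z i)) ⬝ᵥ x := by
  simp only [addCoord, LinearEquiv.coe_mk, LinearMap.coe_mk, AddHom.coe_mk, dotProduct_add,
    add_dotProduct, dotProduct_single, single_dotProduct]
  ring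

variable [DecidableEq F]

theorem hammingNorm_le_card {x : Fin n → F} {S : Finset (Fin n)} (h : ∀ i ∉ S, x i = 0) :
    hammingNorm x ≤ S.card :=
  Finset.card_le_card fun i hi => by
    by_contra hiS
    exact (Finset.mem_filter.mp hi).2 (h i hiS)

/-- The pair `V ≤ W` has minimum distance `d` as a CSS pair, and `W \ V` contains a word of
weight `d`. -/
structure IsCSSPair (V W : Submodule F (Fin n → F)) (d : ℕ) : Prop where
  le : V ≤ W
  le_norm : ∀ x ∈ W, x ∉ V → d ≤ hammingNorm x
  le_norm_dual : ∀ z : Fin n → F, (∀ v ∈ V, z ⬝ᵥ v = 0) → (∃ w ∈ W, z ⬝ᵥ w ≠ 0) →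
    d ≤ hammingNorm z
  exists_norm_eq : ∃ x ∈ W, x ∉ V ∧ hammingNorm x = d

variable {V W : Submodule F (Fin n → F)} {d : ℕ}

/-- The bound on W \ V handles shift errors and the dual bound handles phase errors. A shift by a
word of W \ V of weight d is undetected. -/
theorem IsCSSPair.isQuantumCode [Fintype F] (h : IsCSSPair V W d) {κ : ℕ} (hκ : κ ≠ 0)
    (hr : Module.finrank F W = Module.finrank F V + κ) :
    IsQuantumCode (Fintype.card F) n κ d (cosetCode V W) := by
  have hrank := finrank_cosetCode h.le hr
  refine ⟨hrank, fun S hS E hE => detects_cosetCode h.le hE (fun x hx hxS => ?_)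
    (exists_mem_eqOn_of_dual fun z hz hzS w hw => ?_) ?_, ?_⟩
  · by_contra hxV
    exact absurd ((h.le_norm x hx hxV).trans (hammingNorm_le_card hxS)) (not_le.mpr hS)
  · by_contra hzw
    exact absurd ((h.le_norm_dual z hz ⟨w, hw, hzw⟩).trans (hammingNorm_le_card hzS))
      (not_le.mpr hS)
  · rw [hrank]
    exact (Nat.one_lt_pow hκ Fintype.one_lt_card).ne'
  · obtain ⟨x, hxW, hxV, hx⟩ := h.exists_norm_eq
    refine ⟨Finset.univ.filter fun i => x i ≠ 0, hx, _, actsOn_shiftMatrix (w := x) (by simp),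
      not_detects_shiftMatrix h.le ⟨x, hxW⟩ hxV⟩

/-- For a single state, purity replaces W \ V by the nonzero words of V, and likewise in the dual.
-/
theorem isQuantumCode_cosetCode_self [Fintype F] (h1 : ∀ x ∈ V, x ≠ 0 → d ≤ hammingNorm x)
    (h2 : ∀ z : Fin n → F, (∀ v ∈ V, z ⬝ᵥ v = 0) → z ≠ 0 → d ≤ hammingNorm z)
    (h3 : ∃ x ∈ V, x ≠ 0 ∧ hammingNorm x = d) :
    IsQuantumCode (Fintype.card F) n 0 d (cosetCode V V) := by
  have hrank := finrank_cosetCode (V := V) le_rfl (κ := 0) rfl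
  refine ⟨hrank, fun S hS E hE => detects_cosetCode_self hE (fun x hx hxS => ?_) fun x => ?_, ?_⟩
  · by_contra hx0
    exact absurd ((h1 x hx hx0).trans (hammingNorm_le_card hxS)) (not_le.mpr hS)
  · refine exists_mem_eqOn_of_dual (W := ⊤) (fun z hz hzS w _ => ?_) x trivial
    by_cases hz0 : z = 0
    · simp [hz0]
    · exact absurd ((h2 z hz hz0).trans (hammingNorm_le_card hzS)) (not_le.mpr hS)
  · obtain ⟨x, hxV, hx0, hx⟩ := h3
    exact ⟨Finset.univ.filter fun i => x i ≠ 0, hx, _, actsOn_shiftMatrix (w := x) (by simp),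
      not_detects_shiftMatrix_self (by simpa using hrank) ⟨x, hxV⟩ hx0⟩

theorem hammingNorm_le_add_single (x : Fin n → F) (i : Fin n) (a : F) :
    hammingNorm x ≤ hammingNorm (x + Pi.single i a) + 1 := by
  have h : (Finset.univ.filter fun k => x k ≠ 0) ⊆
      insert i (Finset.univ.filter fun k => (x + Pi.single i a : Fin n → F) k ≠ 0) := by
    intro k hk
    by_cases hki : k = i
    · simp [hki]
    · simpa [hki] using hk
  exact (Finset.card_le_card h).trans (Finset.card_insert_le _ _)

/-- A shear lowers any weight by at most one, in the codes and, through its transpose, in the duals,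
so both bounds drop by at most one. The shear is chosen to erase one coordinate of a word of weight
d + 1. As d ≠ 0, that word has a second nonzero coordinate to subtract. -/
theorem IsCSSPair.exists_pred (h : IsCSSPair V W (d + 1)) (hd : d ≠ 0) :
    ∃ V' W' : Submodule F (Fin n → F), Module.finrank F V' = Module.finrank F V ∧
      Module.finrank F W' = Module.finrank F W ∧ IsCSSPair V' W' d := by
  obtain ⟨x, hxW, hxV, hx⟩ := h.exists_norm_eq
  obtain ⟨i, hi, j, hj, hij⟩ := Finset.one_lt_card.mp
    (show 1 < (Finset.univ.filter fun i => x i ≠ 0).card from lt_of_lt_of_eq (by omega) hx.symm)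
  have hi0 := (Finset.mem_filter.mp hi).2
  have hj0 := (Finset.mem_filter.mp hj).2
  -- This coefficient makes coordinate i of the image of x vanish.
  set e := addCoord hij (-(x i / x j)) with he
  have hnorm : ∀ y, hammingNorm y ≤ hammingNorm (e y) + 1 := fun y =>
    hammingNorm_le_add_single y i _
  have h1 : ∀ y ∈ W.map (e : (Fin n → F) →ₗ[F] (Fin n → F)),
      y ∉ V.map (e : (Fin n → F) →ₗ[F] (Fin n → F)) → d ≤ hammingNorm y := by
    rintro _ ⟨y, hy, rfl⟩ hyV
    have := h.le_norm y hy fun h' => hyV ⟨y, h', rfl⟩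
    have := hnorm y
    simp only [LinearEquiv.coe_coe]
    omega
  have hex : e x ∉ V.map (e : (Fin n → F) →ₗ[F] (Fin n → F)) := by
    rintro ⟨y, hy, hyx⟩
    exact hxV (e.injective hyx ▸ hy)
  refine ⟨V.map (e : (Fin n → F) →ₗ[F] (Fin n → F)), W.map (e : (Fin n → F) →ₗ[F] (Fin n → F)),
    e.finrank_map_eq V, e.finrank_map_eq W, Submodule.map_mono h.le, h1, ?_,
    e x, ⟨x, hxW, rfl⟩, hex, le_antisymm ?_ (h1 _ ⟨x, hxW, rfl⟩ hex)⟩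
  · rintro z hz ⟨_, ⟨w, hw, rfl⟩, hzw⟩
    have := h.le_norm_dual (z + Pi.single j (-(x i / x j) * z i))
      (fun v hv => by rw [← dotProduct_addCoord hij]; exact hz _ ⟨v, hv, rfl⟩)
      ⟨w, hw, by rw [← dotProduct_addCoord hij]; exact hzw⟩
    have h' := hammingNorm_le_add_single (z + Pi.single j (-(x i / x j) * z i)) j
      (-(-(x i / x j) * z i))
    rw [add_assoc, ← Pi.single_add, add_neg_cancel, Pi.single_zero, add_zero] at h'
    omega
  · have hsub : (Finset.univ.filter fun k => e x k ≠ 0) ⊆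
        (Finset.univ.filter fun k => x k ≠ 0).erase i := by
      intro k hk
      have hk := (Finset.mem_filter.mp hk).2
      have hek : e x k = x k + (Pi.single i (-(x i / x j) * x j) : Fin n → F) k := rfl
      have hki : k ≠ i := by
        rintro rfl
        refine hk ?_
        rw [hek, Pi.single_eq_same]
        field_simp
        ring
      rw [hek, Pi.single_eq_of_ne hki, add_zero] at hk
      simp [hki, hk]
    have := Finset.card_le_card hsub
    rw [Finset.card_erase_of_mem hi] at this
    have hx' : (Finset.univ.filter fun k => x k ≠ 0).card = d + 1 := hx
    rw [hx'] at this
    exact this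

theorem IsCSSPair.exists_of_le {d' : ℕ} (h : IsCSSPair V W d') (hd : d ≠ 0) (hdd : d ≤ d') :
    ∃ V' W' : Submodule F (Fin n → F), Module.finrank F V' = Module.finrank F V ∧
      Module.finrank F W' = Module.finrank F W ∧ IsCSSPair V' W' d := by
  induction d', hdd using Nat.le_induction generalizing V W with
  | base => exact ⟨V, W, rfl, rfl, h⟩
  | succ m hm ih =>
    obtain ⟨V₁, W₁, hV₁, hW₁, h₁⟩ := h.exists_pred (by omega)
    obtain ⟨V₂, W₂, hV₂, hW₂, h₂⟩ := ih h₁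
    exact ⟨V₂, W₂, hV₂.trans hV₁, hW₂.trans hW₁, h₂⟩

/-! ### Euclidean duals and the quantum code of a dual-containing code -/

/-- The Euclidean dual of a code. -/
def dualCode {ι F : Type*} [Fintype ι] [Field F] (C : Submodule F (ι → F)) :
    Submodule F (ι → F) where
  carrier := {z | ∀ c ∈ C, z ⬝ᵥ c = 0}
  zero_mem' c _ := zero_dotProduct c
  add_mem' hx hy c hc := by rw [add_dotProduct, hx c hc, hy c hc, add_zero]
  smul_mem' t x hx c hc := by rw [smul_dotProduct, hx c hc, smul_zero]

theorem mem_dualCode {ι F : Type*} [Fintype ι] [Field F] {C : Submodule F (ι → F)} {z : ι → F} :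
    z ∈ dualCode C ↔ ∀ c ∈ C, z ⬝ᵥ c = 0 := Iff.rfl

theorem finrank_add_finrank_dualCode {ι F : Type*} [Fintype ι] [Field F]
    (C : Submodule F (ι → F)) :
    Module.finrank F C + Module.finrank F (dualCode C) = Fintype.card ι := by
  classical
  have h : dualCode C = C.dualAnnihilator.map ((dotProductEquiv F ι).symm :
      Module.Dual F (ι → F) →ₗ[F] (ι → F)) := by
    ext z
    rw [Submodule.map_equiv_eq_comap_symm, Submodule.mem_comap, Submodule.mem_dualAnnihilator]
    rfl
  rw [h, LinearEquiv.finrank_map_eq, Subspace.finrank_add_finrank_dualAnnihilator_eq,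
    Module.finrank_fintype_fun_eq_card]

theorem dualCode_dualCode {ι F : Type*} [Fintype ι] [Field F] (C : Submodule F (ι → F)) :
    dualCode (dualCode C) = C := by
  refine (Submodule.eq_of_le_of_finrank_eq
    (fun c hc z hz => by rw [dotProduct_comm]; exact hz c hc) ?_).symm
  have h1 := finrank_add_finrank_dualCode C
  have h2 := finrank_add_finrank_dualCode (dualCode C)
  omega

theorem exists_isQuantumCode_of_dualCode_le [Fintype F] {C : Submodule F (Fin n → F)}
    (hC : dualCode C ≤ C) (hn : 0 < n) :
    n ≤ 2 * Module.finrank F C ∧ ∃ Q : Submodule ℂ (QuditSpace (Fintype.card F) n),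
      IsQuantumCode (Fintype.card F) n (2 * Module.finrank F C - n) (minHammingDist C) Q := by
  have hdim := finrank_add_finrank_dualCode C
  rw [Fintype.card_fin] at hdim
  have hle := Submodule.finrank_mono hC
  refine ⟨by omega, ?_⟩
  have hset : {d | ∃ c ∈ C, ∃ c' ∈ C, c ≠ c' ∧ hammingDist c c' = d} =
      {d | ∃ c ∈ C, c ≠ 0 ∧ hammingNorm c = d} := by
    ext d
    constructor
    · rintro ⟨c, hc, c', hc', hne, rfl⟩
      exact ⟨-c + c', C.add_mem (C.neg_mem hc) hc', fun h => hne (neg_add_eq_zero.mp h),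
        (hammingDist_eq_hammingNorm _ _).symm⟩
    · rintro ⟨c, hc, hne, rfl⟩
      exact ⟨c, hc, 0, C.zero_mem, hne, hammingDist_zero_right c⟩
  -- The zero code would have the whole space, of dimension n > 0, as its dual. Excluding it keeps
  -- `sInf` off the empty set, where it defaults to 0.
  have hC0 : C ≠ ⊥ := by
    rintro rfl
    rw [finrank_bot] at *
    omega
  obtain ⟨c, hc, hc0⟩ := C.ne_bot_iff.mp hC0
  have hmem := Nat.sInf_mem (s := {d | ∃ c ∈ C, c ≠ 0 ∧ hammingNorm c = d}) ⟨_, c, hc, hc0, rfl⟩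
  have hmin : ∀ x ∈ C, x ≠ 0 → minHammingDist C ≤ hammingNorm x := fun x hx hx0 => by
    rw [minHammingDist, hset]
    exact Nat.sInf_le ⟨x, hx, hx0, rfl⟩
  rw [← hset] at hmem
  change minHammingDist C ∈ _ at hmem
  rw [hset] at hmem
  -- Self-dual codes give κ = 0 and need the purity argument, since C \ C^⊥ is then empty.
  rcases hC.eq_or_lt with heq | hlt
  · have hk : 2 * Module.finrank F C - n = 0 := by rw [heq] at hdim; omega
    rw [hk]
    exact ⟨_, isQuantumCode_cosetCode_self hmin
      (fun z hz hz0 => hmin z (heq ▸ (mem_dualCode.mpr hz)) hz0) hmem⟩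
  · have hlt' := Submodule.finrank_lt_finrank_of_lt hlt
    obtain ⟨w, hwC, hwd⟩ := SetLike.exists_of_lt hlt
    have hex : ∃ d, ∃ x ∈ C, x ∉ dualCode C ∧ hammingNorm x = d := ⟨_, w, hwC, hwd, rfl⟩
    classical
    -- By biduality V^⊥ \ W^⊥ is again C \ C^⊥, so one minimum weight serves both bounds.
    have hpair : IsCSSPair (dualCode C) C (Nat.find hex) :=
      ⟨hC, fun x hx hxd => Nat.find_min' hex ⟨x, hx, hxd, rfl⟩,
        fun z hz ⟨c, hc, hzc⟩ => Nat.find_min' hex ⟨z, (dualCode_dualCode C).le hz,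
          fun h => hzc (h c hc), rfl⟩, Nat.find_spec hex⟩
    obtain ⟨x, hx, hx0, hxn⟩ := hmem
    obtain ⟨y, hy, hyd, hyn⟩ := Nat.find_spec hex
    obtain ⟨V, W, hV, hW, hVW⟩ := hpair.exists_of_le (d := minHammingDist C)
      (by rw [← hxn]; exact hammingNorm_ne_zero_iff.mpr hx0)
      (by rw [← hyn]; exact hmin y hy fun h => hyd (h ▸ Submodule.zero_mem _))
    exact ⟨_, hVW.isQuantumCode (by omega) (by omega)⟩

end Distance

/-! ### Dual-containing codes generated by polynomials -/

/-- The rows of A give dim C ≥ r, hence dim C^⊥ ≤ n - r ≤ s. The s independent rows of B lie in C^⊥,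
so they span it, and they also lie in C. -/
theorem dualCode_le_of_range_le {F : Type*} [Field F] {n r s : ℕ} {C : Submodule F (Fin n → F)}
    {A : Matrix (Fin r) (Fin n) F} {B : Matrix (Fin s) (Fin n) F} (hrs : n ≤ r + s)
    (hA : Function.Injective A.vecMulLinear) (hB : Function.Injective B.vecMulLinear)
    (hAC : ∀ m, m ᵥ* A ∈ C) (hBC : ∀ m, m ᵥ* B ∈ C) (hort : ∀ c ∈ C, ∀ j, B j ⬝ᵥ c = 0) :
    dualCode C ≤ C := by
  have hBd : LinearMap.range B.vecMulLinear ≤ dualCode C := by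
    rintro _ ⟨m, rfl⟩ c hc
    rw [Matrix.vecMulLinear_apply, ← Matrix.dotProduct_mulVec]
    have : B *ᵥ c = 0 := funext fun j => hort c hc j
    rw [this, dotProduct_zero]
  have h1 : LinearMap.range A.vecMulLinear ≤ C := by
    rintro _ ⟨m, rfl⟩
    exact hAC m
  have h2 := LinearMap.finrank_range_of_inj hA
  have h3 := LinearMap.finrank_range_of_inj hB
  have h4 := Submodule.finrank_mono h1
  have h5 := finrank_add_finrank_dualCode C
  simp only [Module.finrank_fintype_fun_eq_card, Fintype.card_fin] at h2 h3 h5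
  rw [← Submodule.eq_of_le_of_finrank_le hBd (by omega)]
  rintro _ ⟨m, rfl⟩
  exact hBC m

/-! ### Skew cyclic codes over F -/

section Skew

variable {F : Type*} [Field F] {Θ : RingAut F}

/-- The coefficient of `x ^ i` in a skew polynomial, as an element of `F`. -/
def skewCoeff (p : SkewPoly Θ) (i : ℕ) : F := SkewPolynomial.coeff p i

/-- The skew polynomial `a x ^ i`. -/
def skewMonomial (Θ : RingAut F) (i : ℕ) (a : F) : SkewPoly Θ :=
  SkewPolynomial.monomial i (show Twisted Θ from a)

theorem mem_support_iff_skewCoeff {p : SkewPoly Θ} {i : ℕ} :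
    i ∈ SkewPolynomial.support p ↔ skewCoeff p i ≠ 0 :=
  SkewPolynomial.mem_support_iff

theorem skewPoly_ext {p q : SkewPoly Θ} (h : ∀ i, skewCoeff p i = skewCoeff q i) : p = q :=
  SkewPolynomial.ext h

theorem skewCoeff_zero (i : ℕ) : skewCoeff (0 : SkewPoly Θ) i = 0 := rfl

theorem skewCoeff_add (p q : SkewPoly Θ) (i : ℕ) :
    skewCoeff (p + q) i = skewCoeff p i + skewCoeff q i :=
  congrFun (congrArg DFunLike.coe (SkewMonoidAlgebra.coeff_add p q)) (Multiplicative.ofAdd i)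

theorem skewCoeff_sub (p q : SkewPoly Θ) (i : ℕ) :
    skewCoeff (p - q) i = skewCoeff p i - skewCoeff q i := by
  rw [eq_sub_iff_add_eq, ← skewCoeff_add, sub_add_cancel]

theorem skewCoeff_sum {ι : Type*} (s : Finset ι) (p : ι → SkewPoly Θ) (i : ℕ) :
    skewCoeff (∑ j ∈ s, p j) i = ∑ j ∈ s, skewCoeff (p j) i := by
  classical
  induction s using Finset.induction_on with
  | empty => rfl
  | insert a s ha ih => rw [Finset.sum_insert ha, Finset.sum_insert ha, skewCoeff_add, ih]

theorem skewCoeff_skewMonomial (j i : ℕ) (a : F) :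
    skewCoeff (skewMonomial Θ j a) i = if j = i then a else 0 :=
  SkewPolynomial.coeff_monomial

theorem skewCoeff_mul (p q : SkewPoly Θ) (m : ℕ) :
    skewCoeff (p * q) m = ∑ ij ∈ Finset.HasAntidiagonal.antidiagonal m,
      skewCoeff p ij.1 * (Θ ^ ij.1 : RingAut F) (skewCoeff q ij.2) := by
  refine (SkewMonoidAlgebra.coeff_mul_antidiagonal_of_finset p q (Multiplicative.ofAdd m)
    ((Finset.HasAntidiagonal.antidiagonal m).map (Equiv.prodCongr Multiplicative.ofAdd
      Multiplicative.ofAdd).toEmbedding) ?_).trans ?_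
  · intro x
    constructor
    · intro h
      obtain ⟨y, hy, rfl⟩ := Finset.mem_map.mp h
      exact congrArg Multiplicative.ofAdd (Finset.HasAntidiagonal.mem_antidiagonal.mp hy)
    · intro h
      exact Finset.mem_map.mpr ⟨(x.1.toAdd, x.2.toAdd),
        Finset.HasAntidiagonal.mem_antidiagonal.mpr (congrArg Multiplicative.toAdd h), rfl⟩
  · exact Finset.sum_map _ _ _

theorem skewCoeff_eq_zero {p : SkewPoly Θ} {i : ℕ} (h : skewDegree p < i) :
    skewCoeff p i = 0 := by
  by_contra hi
  exact absurd (Finset.le_sup (f := id) (mem_support_iff_skewCoeff.mpr hi)) (not_le.mpr h)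

theorem skewCoeff_skewDegree_ne_zero {p : SkewPoly Θ} (hp : p ≠ 0) :
    skewCoeff p (skewDegree p) ≠ 0 := by
  obtain ⟨i, hi, h⟩ := Finset.exists_mem_eq_sup (SkewPolynomial.support p)
    (Finset.nonempty_iff_ne_empty.mpr fun h => hp (SkewPolynomial.support_eq_empty.mp h)) id
  rw [skewDegree, h]
  exact mem_support_iff_skewCoeff.mp hi

theorem le_skewDegree {p : SkewPoly Θ} {i : ℕ} (h : skewCoeff p i ≠ 0) :
    i ≤ skewDegree p :=
  not_lt.mp fun h' => h (skewCoeff_eq_zero h')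

theorem skewDegree_lt_of_coeff {p : SkewPoly Θ} {n : ℕ} (hn : 0 < n)
    (h : ∀ i, n ≤ i → skewCoeff p i = 0) : skewDegree p < n :=
  (Finset.sup_lt_iff hn).mpr fun i hi => not_le.mp fun h' =>
    mem_support_iff_skewCoeff.mp hi (h i h')

theorem skewCoeff_mul_skewDegree (p q : SkewPoly Θ) :
    skewCoeff (p * q) (skewDegree p + skewDegree q) =
      skewCoeff p (skewDegree p) *
        ((Θ ^ skewDegree p : RingAut F) (skewCoeff q (skewDegree q))) := by
  rw [skewCoeff_mul, Finset.sum_eq_single (skewDegree p, skewDegree q)]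
  · rintro ⟨i, j⟩ hij hne
    have hij := Finset.HasAntidiagonal.mem_antidiagonal.mp hij
    rcases lt_trichotomy i (skewDegree p) with h | h | h
    · rw [skewCoeff_eq_zero (p := q) (show skewDegree q < j by omega)]
      rw [map_zero, mul_zero]
    · exact absurd (Prod.ext h (by simp only at hij ⊢; omega)) hne
    · rw [skewCoeff_eq_zero h, zero_mul]
  · intro h
    simp at h

theorem skew_coeff_mul_ne_zero {p q : SkewPoly Θ} (hp : p ≠ 0) (hq : q ≠ 0) :
    skewCoeff (p * q) (skewDegree p + skewDegree q) ≠ 0 := by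
  rw [skewCoeff_mul_skewDegree]
  exact mul_ne_zero (skewCoeff_skewDegree_ne_zero hp)
    ((map_ne_zero (Θ ^ skewDegree p : RingAut F)).mpr (skewCoeff_skewDegree_ne_zero hq))

instance : NoZeroDivisors (SkewPoly Θ) where
  eq_zero_or_eq_zero_of_mul_eq_zero {p q} h := by
    by_contra! hpq
    exact skew_coeff_mul_ne_zero hpq.1 hpq.2 (by rw [h]; rfl)

theorem skewCoeff_mul_eq_zero {p q : SkewPoly Θ} {i : ℕ}
    (h : skewDegree p + skewDegree q < i) : skewCoeff (p * q) i = 0 := by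
  rw [skewCoeff_mul]
  refine Finset.sum_eq_zero fun ij hij => ?_
  have hij := Finset.HasAntidiagonal.mem_antidiagonal.mp hij
  by_cases hi : skewDegree p < ij.1
  · rw [skewCoeff_eq_zero hi, zero_mul]
  · rw [skewCoeff_eq_zero (p := q) (show skewDegree q < ij.2 by omega)]
    rw [map_zero, mul_zero]

theorem skewDegree_mul {p q : SkewPoly Θ} (hp : p ≠ 0) (hq : q ≠ 0) :
    skewDegree (p * q) = skewDegree p + skewDegree q :=
  le_antisymm (not_lt.mp fun h => skewCoeff_skewDegree_ne_zero (mul_ne_zero hp hq)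
    (skewCoeff_mul_eq_zero h)) (le_skewDegree (skew_coeff_mul_ne_zero hp hq))

/-- The skew polynomial `∑ c_i x ^ i` of a word `c`. -/
def skewPolyOf (Θ : RingAut F) {n : ℕ} (c : Fin n → F) : SkewPoly Θ :=
  ∑ i : Fin n, skewMonomial Θ i (c i)

theorem skewCoeff_skewPolyOf {n : ℕ} (c : Fin n → F) (i : Fin n) :
    skewCoeff (skewPolyOf Θ c) i = c i := by
  rw [skewPolyOf, skewCoeff_sum, Finset.sum_eq_single i]
  · rw [skewCoeff_skewMonomial, if_pos rfl]
  · intro j _ hj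
    rw [skewCoeff_skewMonomial, if_neg (Fin.val_ne_of_ne hj)]
  · simp

theorem skewCoeff_skewPolyOf_of_le {n : ℕ} (c : Fin n → F) {i : ℕ} (h : n ≤ i) :
    skewCoeff (skewPolyOf Θ c) i = 0 := by
  rw [skewPolyOf, skewCoeff_sum]
  refine Finset.sum_eq_zero fun j _ => ?_
  rw [skewCoeff_skewMonomial, if_neg (by omega)]

/-- The matrix whose rows are the words of `p, x p, …, x ^ (r - 1) p`. -/
def skewGenMatrix (p : SkewPoly Θ) (r n : ℕ) : Matrix (Fin r) (Fin n) F :=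
  fun j i => skewCoeff (skewMonomial Θ j 1 * p) i

theorem skewCoeff_monomial_mul (p : SkewPoly Θ) (j i : ℕ) (a : F) :
    skewCoeff (skewMonomial Θ j a * p) i =
      if j ≤ i then a * ((Θ ^ j : RingAut F) (skewCoeff p (i - j))) else 0 := by
  rw [skewCoeff_mul]
  split_ifs with h
  · rw [Finset.sum_eq_single (j, i - j)]
    · rw [skewCoeff_skewMonomial, if_pos rfl]
    · rintro ⟨k, l⟩ hkl hne
      have hkl := Finset.HasAntidiagonal.mem_antidiagonal.mp hkl
      rw [skewCoeff_skewMonomial, if_neg]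
      · rw [zero_mul]
      · rintro rfl
        exact hne (Prod.ext rfl (by simp only at hkl ⊢; omega))
    · intro h'
      exact absurd (Finset.HasAntidiagonal.mem_antidiagonal.mpr (by simp only; omega)) h'
  · refine Finset.sum_eq_zero fun kl hkl => ?_
    have hkl := Finset.HasAntidiagonal.mem_antidiagonal.mp hkl
    rw [skewCoeff_skewMonomial, if_neg (by omega), zero_mul]

theorem vecMul_skewGenMatrix (p : SkewPoly Θ) {r n : ℕ} (m : Fin r → F) (i : Fin n) :
    (m ᵥ* skewGenMatrix p r n) i = skewCoeff (skewPolyOf Θ m * p) i := by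
  rw [skewPolyOf, Finset.sum_mul, skewCoeff_sum, Matrix.vecMul, dotProduct]
  refine Finset.sum_congr rfl fun j _ => ?_
  rw [skewGenMatrix, skewCoeff_monomial_mul, skewCoeff_monomial_mul]
  split_ifs
  · rw [one_mul]
  · rw [mul_zero]

theorem skewDegree_skewPolyOf_lt {r : ℕ} (m : Fin r → F) (hr : 0 < r) :
    skewDegree (skewPolyOf Θ m) < r :=
  skewDegree_lt_of_coeff hr fun _ h => skewCoeff_skewPolyOf_of_le m h

theorem skewPolyOf_vecMul_skewGenMatrix {p : SkewPoly Θ} {r n : ℕ}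
    (hp : skewDegree p + r ≤ n) (m : Fin r → F) :
    skewPolyOf Θ (m ᵥ* skewGenMatrix p r n) = skewPolyOf Θ m * p := by
  refine skewPoly_ext fun i => ?_
  by_cases hi : i < n
  · exact (skewCoeff_skewPolyOf _ ⟨i, hi⟩).trans (vecMul_skewGenMatrix p m ⟨i, hi⟩)
  · rw [skewCoeff_skewPolyOf_of_le _ (not_lt.mp hi)]
    rcases Nat.eq_zero_or_pos r with rfl | hr
    · have : skewPolyOf Θ m = 0 := by
        rw [skewPolyOf, Finset.univ_eq_empty, Finset.sum_empty]
      rw [this, zero_mul, skewCoeff_zero]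
    · have := skewDegree_skewPolyOf_lt (Θ := Θ) m hr
      rw [skewCoeff_mul_eq_zero (by omega)]

theorem skewPolyOf_injective (n : ℕ) : Function.Injective (skewPolyOf (n := n) Θ) := by
  intro c c' h
  ext i
  rw [← skewCoeff_skewPolyOf (Θ := Θ) c i, h, skewCoeff_skewPolyOf]

theorem vecMulLinear_skewGenMatrix_injective {p : SkewPoly Θ} (hp0 : p ≠ 0) {r n : ℕ}
    (hp : skewDegree p + r ≤ n) : Function.Injective (skewGenMatrix p r n).vecMulLinear := by
  intro m m' h
  have h' := congrArg (skewPolyOf Θ) h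
  rw [Matrix.vecMulLinear_apply, Matrix.vecMulLinear_apply, skewPolyOf_vecMul_skewGenMatrix hp,
    skewPolyOf_vecMul_skewGenMatrix hp] at h'
  exact skewPolyOf_injective r (mul_right_cancel₀ hp0 h')

theorem xPowSubOne_eq (n : ℕ) :
    xPowSubOne Θ n = skewMonomial Θ n 1 - skewMonomial Θ 0 1 := by
  rw [xPowSubOne, SkewPolynomial.X_pow_eq_monomial]
  rfl

theorem skewCoeff_xPowSubOne {n : ℕ} (i : ℕ) :
    skewCoeff (xPowSubOne Θ n) i =
      (if n = i then 1 else 0) - (if 0 = i then 1 else 0) := by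
  rw [xPowSubOne_eq, skewCoeff_sub, skewCoeff_skewMonomial, skewCoeff_skewMonomial]

theorem xPowSubOne_ne_zero {n : ℕ} (hn : 0 < n) : xPowSubOne Θ n ≠ 0 := by
  intro h
  have := skewCoeff_xPowSubOne (Θ := Θ) (n := n) n
  rw [h, if_pos rfl, if_neg hn.ne, sub_zero] at this
  exact zero_ne_one (α := F) this

theorem skewDegree_xPowSubOne {n : ℕ} (hn : 0 < n) : skewDegree (xPowSubOne Θ n) = n := by
  refine le_antisymm (Nat.lt_succ_iff.mp (skewDegree_lt_of_coeff n.succ_pos fun i hi => ?_))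
    (le_skewDegree ?_)
  · rw [skewCoeff_xPowSubOne, if_neg (by omega), if_neg (by omega), sub_zero]
  · rw [skewCoeff_xPowSubOne, if_pos rfl, if_neg hn.ne, sub_zero]
    exact one_ne_zero (α := F)

/-- Moving x^n past a coefficient applies Θ^n, which is the identity, so x^n is central. -/
theorem commute_xPowSubOne {n : ℕ} (hΘ : Θ ^ n = 1) (p : SkewPoly Θ) :
    Commute (xPowSubOne Θ n) p := by
  refine Commute.sub_left ?_ (Commute.one_left p)
  rw [commute_iff_eq, SkewPolynomial.X_pow_mul]
  congr 1
  have : ∀ a : Twisted Θ, SkewPolynomial.φ^[n] a = a := fun a => by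
    rw [SkewPolynomial.φ_iterate_apply]
    exact congrArg (fun σ : RingAut F => σ a) hΘ
  simp only [this]
  exact SkewPolynomial.sum_monomial p

theorem skewCoeff_dagger (h : SkewPoly Θ) (i : ℕ) :
    skewCoeff (dagger h) i = if i ≤ skewDegree h then
      (Θ ^ i : RingAut F) (skewCoeff h (skewDegree h - i)) else 0 := by
  have hdag : dagger h = ∑ i ∈ Finset.range (skewDegree h + 1),
      skewMonomial Θ i ((Θ ^ i : RingAut F) (skewCoeff h (skewDegree h - i))) := rfl
  rw [hdag, skewCoeff_sum]
  split_ifs with hi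
  · rw [Finset.sum_eq_single i]
    · rw [skewCoeff_skewMonomial, if_pos rfl]
    · intro j _ hj
      rw [skewCoeff_skewMonomial, if_neg hj]
    · intro h'
      exact absurd (Finset.mem_range.mpr (by omega)) h'
  · refine Finset.sum_eq_zero fun j hj => ?_
    have := Finset.mem_range.mp hj
    rw [skewCoeff_skewMonomial, if_neg (by omega)]

theorem skewDegree_dagger_le (h : SkewPoly Θ) : skewDegree (dagger h) ≤ skewDegree h :=
  Nat.lt_succ_iff.mp (skewDegree_lt_of_coeff (Nat.succ_pos _) fun i hi => by
    rw [skewCoeff_dagger, if_neg (by omega)])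

theorem dagger_ne_zero {h : SkewPoly Θ} (hh : h ≠ 0) : dagger h ≠ 0 := by
  intro h0
  have := skewCoeff_dagger h 0
  rw [h0, if_pos (Nat.zero_le _)] at this
  exact skewCoeff_skewDegree_ne_zero hh this.symm

/-- The twists in the reciprocal are arranged for this: coordinate i of x^j h† carries Θ^j Θ^(i-j) =
Θ^i, exactly the twist that x^i puts on the coefficients of h in c h. -/
theorem skewGenMatrix_dagger_dotProduct (h : SkewPoly Θ) {n r : ℕ} (c : Fin n → F)
    (j : Fin r) :
    skewGenMatrix (dagger h) r n j ⬝ᵥ c =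
      skewCoeff (skewPolyOf Θ c * h) (j + skewDegree h) := by
  rw [skewPolyOf, Finset.sum_mul, skewCoeff_sum]
  refine Finset.sum_congr rfl fun i _ => ?_
  rw [skewGenMatrix, skewCoeff_monomial_mul, skewCoeff_monomial_mul, skewCoeff_dagger]
  by_cases hji : (j : ℕ) ≤ i
  · rw [if_pos hji]
    by_cases hi : (i : ℕ) ≤ j + skewDegree h
    · rw [if_pos hi, if_pos (by omega), ← RingAut.mul_apply, ← pow_add,
        show (j : ℕ) + (i - j) = i by omega,
        show skewDegree h - (i - j) = j + skewDegree h - i by omega, one_mul, mul_comm]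
    · rw [if_neg hi, if_neg (by omega), map_zero, mul_zero, zero_mul]
  · rw [if_neg hji, if_pos (by omega), skewCoeff_eq_zero (p := h) (by omega), map_zero, mul_zero,
      zero_mul]

/-- As g right-divides x^n - 1, correcting by left multiples of x^n - 1 stays among the left
multiples of g. -/
theorem IsSkewGeneratedBy.mem_iff {n : ℕ} {C : Submodule F (Fin n → F)} {g h : SkewPoly Θ}
    (hC : IsSkewGeneratedBy Θ C g) (hg : xPowSubOne Θ n = h * g) (c : Fin n → F) :
    c ∈ C ↔ ∃ m, skewPolyOf Θ c = m * g := by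
  rw [hC c, Submodule.mem_span_singleton]
  change (∃ a, a • _ = Submodule.mkQ _ (skewPolyOf Θ c)) ↔ _
  constructor
  · rintro ⟨a, ha⟩
    rw [← map_smul, ← sub_eq_zero, ← map_sub, Submodule.mkQ_apply, Submodule.Quotient.mk_eq_zero,
      Submodule.mem_span_singleton] at ha
    obtain ⟨b, hb⟩ := ha
    refine ⟨a - b * h, ?_⟩
    rw [sub_mul, mul_assoc, ← hg, ← smul_eq_mul b, hb, smul_eq_mul, sub_sub_cancel]
  · rintro ⟨m, hm⟩
    exact ⟨m, by rw [hm, ← map_smul, smul_eq_mul]⟩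

/-- Centrality of x^n - 1 turns h g into g h. Cancelling h in h† h = a g h gives h† = a g, so the
shifts of h† lie in C. They are orthogonal to C because c = m g gives c h = (x^n - 1) m, which has
no terms in degrees deg h, …, n - 1. -/
theorem dualCode_le_of_isSkewGeneratedBy {n : ℕ} (hΘ : Θ ^ n = 1) {C : Submodule F (Fin n → F)}
    {g h : SkewPoly Θ} (hC : IsSkewGeneratedBy Θ C g) (hg : xPowSubOne Θ n = h * g)
    (hd : RightDvd (xPowSubOne Θ n) (dagger h * h)) : dualCode C ≤ C := by
  -- In length 0 the polynomial x^n - 1 is zero and the degree count below breaks down.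
  rcases Nat.eq_zero_or_pos n with rfl | hn
  · intro z _
    rw [Subsingleton.elim z 0]
    exact C.zero_mem
  have hne := xPowSubOne_ne_zero (Θ := Θ) hn
  have hh : h ≠ 0 := fun h0 => hne (by rw [hg, h0, zero_mul])
  have hg0 : g ≠ 0 := fun h0 => hne (by rw [hg, h0, mul_zero])
  have hdeg : skewDegree h + skewDegree g = n := by
    rw [← skewDegree_mul hh hg0, ← hg, skewDegree_xPowSubOne hn]
  have hgh : g * h = xPowSubOne Θ n := by
    refine mul_right_cancel₀ hg0 ?_
    rw [mul_assoc, ← hg, (commute_xPowSubOne hΘ g).eq]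
  obtain ⟨a, ha⟩ := hd
  have hag : dagger h = a * g := by
    refine mul_right_cancel₀ hh ?_
    rw [ha, mul_assoc, hgh]
  have hdh := skewDegree_dagger_le h
  refine dualCode_le_of_range_le (r := skewDegree h) (s := skewDegree g)
    (A := skewGenMatrix g _ n) (B := skewGenMatrix (dagger h) _ n) hdeg.ge
    (vecMulLinear_skewGenMatrix_injective hg0 (by omega))
    (vecMulLinear_skewGenMatrix_injective (dagger_ne_zero hh) (by omega))
    (fun m => (hC.mem_iff hg _).mpr ⟨_, skewPolyOf_vecMul_skewGenMatrix (by omega) m⟩)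
    (fun m => (hC.mem_iff hg _).mpr ⟨skewPolyOf Θ m * a, ?_⟩) fun c hc j => ?_
  · rw [skewPolyOf_vecMul_skewGenMatrix (by omega), hag, mul_assoc]
  · rw [skewGenMatrix_dagger_dotProduct]
    obtain ⟨m, hm⟩ := (hC.mem_iff hg c).mp hc
    by_cases hm0 : m = 0
    · rw [hm, hm0, zero_mul, zero_mul, skewCoeff_zero]
    · have hlt : skewDegree m < skewDegree h := by
        have h1 := skewDegree_mul hm0 hg0
        have h2 := skewDegree_skewPolyOf_lt (Θ := Θ) c hn
        rw [hm] at h2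
        omega
      have hj := j.2
      -- The degree j + deg h lies strictly between deg m and n, in the gap between the terms of m
      -- and those of x^n m.
      rw [hm, mul_assoc, hgh, ← (commute_xPowSubOne hΘ m).eq, xPowSubOne_eq, sub_mul,
        skewCoeff_sub, skewCoeff_monomial_mul, skewCoeff_monomial_mul, if_neg (by omega),
        if_pos (Nat.zero_le _), Nat.sub_zero, skewCoeff_eq_zero (p := m) (by omega), map_zero,
        mul_zero, sub_zero]

end Skew

/-! ### Cyclic codes over F -/

section Cyclic

open Polynomial

variable {F : Type*} [Field F]

/-- The polynomial `∑ c_i x ^ i` of a word `c`. -/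
def polyOf {n : ℕ} (c : Fin n → F) : F[X] := ∑ i : Fin n, monomial (i : ℕ) (c i)

theorem coeff_polyOf {n : ℕ} (c : Fin n → F) (i : Fin n) : (polyOf c).coeff i = c i := by
  simp [polyOf, coeff_monomial, Fin.val_inj]

theorem coeff_polyOf_of_le {n : ℕ} (c : Fin n → F) {i : ℕ} (h : n ≤ i) :
    (polyOf c).coeff i = 0 := by
  rw [polyOf, finsetSum_coeff]
  exact Finset.sum_eq_zero fun j _ => coeff_monomial_of_ne _ (by omega)

theorem degree_polyOf_lt {n : ℕ} (c : Fin n → F) : (polyOf c).degree < n :=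
  (degree_lt_iff_coeff_zero _ _).mpr fun _ h => coeff_polyOf_of_le c h

theorem polyOf_injective (n : ℕ) : Function.Injective (polyOf (F := F) (n := n)) := by
  intro c c' h
  ext i
  rw [← coeff_polyOf c i, h, coeff_polyOf]

/-- The matrix whose rows are the words of `p, x p, …, x ^ (r - 1) p`. -/
def genMatrix (p : F[X]) (r n : ℕ) : Matrix (Fin r) (Fin n) F :=
  fun j i => (X ^ (j : ℕ) * p).coeff i

theorem vecMul_genMatrix (p : F[X]) {r n : ℕ} (m : Fin r → F) (i : Fin n) :
    (m ᵥ* genMatrix p r n) i = (polyOf m * p).coeff i := by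
  rw [polyOf, Finset.sum_mul, finsetSum_coeff, Matrix.vecMul, dotProduct]
  refine Finset.sum_congr rfl fun j _ => ?_
  rw [← C_mul_X_pow_eq_monomial, mul_assoc, coeff_C_mul]
  rfl

theorem polyOf_vecMul_genMatrix {p : F[X]} {r n : ℕ} (hp0 : p ≠ 0) (hp : p.natDegree + r ≤ n)
    (m : Fin r → F) : polyOf (m ᵥ* genMatrix p r n) = polyOf m * p := by
  ext i
  by_cases hi : i < n
  · exact (coeff_polyOf _ ⟨i, hi⟩).trans (vecMul_genMatrix p m ⟨i, hi⟩)
  · rw [coeff_polyOf_of_le _ (not_lt.mp hi), coeff_eq_zero_of_degree_lt]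
    by_cases hm : polyOf m = 0
    · rw [hm, zero_mul, degree_zero]
      exact WithBot.bot_lt_coe i
    · have h := degree_polyOf_lt m
      rw [← natDegree_lt_iff_degree_lt hm] at h
      rw [← natDegree_lt_iff_degree_lt (mul_ne_zero hm hp0), natDegree_mul hm hp0]
      omega

theorem vecMulLinear_genMatrix_injective {p : F[X]} (hp0 : p ≠ 0) {r n : ℕ}
    (hp : p.natDegree + r ≤ n) : Function.Injective (genMatrix p r n).vecMulLinear := by
  intro m m' h
  have h' := congrArg polyOf h
  rw [Matrix.vecMulLinear_apply, Matrix.vecMulLinear_apply, polyOf_vecMul_genMatrix hp0 hp,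
    polyOf_vecMul_genMatrix hp0 hp] at h'
  exact polyOf_injective r (mul_right_cancel₀ hp0 h')

theorem genMatrix_reverse_dotProduct (h : F[X]) {n r : ℕ} (c : Fin n → F) (j : Fin r) :
    genMatrix h.reverse r n j ⬝ᵥ c = (polyOf c * h).coeff (j + h.natDegree) := by
  rw [polyOf, Finset.sum_mul, finsetSum_coeff]
  refine Finset.sum_congr rfl fun i _ => ?_
  rw [genMatrix, ← C_mul_X_pow_eq_monomial, mul_assoc, coeff_C_mul, coeff_X_pow_mul',
    coeff_X_pow_mul', mul_comm]
  congr 1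
  by_cases hji : (j : ℕ) ≤ i
  · rw [if_pos hji, coeff_reverse]
    by_cases hi : (i : ℕ) ≤ j + h.natDegree
    · rw [if_pos hi, revAt_le (by omega)]
      congr 1
      omega
    · rw [if_neg hi, revAt_eq_self_of_lt (by omega), coeff_eq_zero_of_natDegree_lt (by omega)]
  · rw [if_neg hji, if_pos (by omega), coeff_eq_zero_of_natDegree_lt (by omega)]

theorem IsGeneratedBy.mem_iff {n : ℕ} {C : Submodule F (Fin n → F)} {f : F[X]}
    (hC : IsGeneratedBy C f) (hf : f ∣ X ^ n - 1) (c : Fin n → F) :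
    c ∈ C ↔ f ∣ polyOf c := by
  rw [hC c, Ideal.mem_span_singleton]
  change Ideal.Quotient.mk _ f ∣ Ideal.Quotient.mk _ (polyOf c) ↔ _
  constructor
  · rintro ⟨a, ha⟩
    obtain ⟨a, rfl⟩ := Ideal.Quotient.mk_surjective a
    rw [← map_mul, Ideal.Quotient.eq, Ideal.mem_span_singleton] at ha
    simpa using dvd_add (hf.trans ha) (dvd_mul_right f a)
  · exact fun h => map_dvd _ h

/-- Reversal loses only a power of X dividing p. Without one it coincides with the involution
`mirror`. -/
theorem reverse_reverse_of_coeff_zero_ne_zero {p : F[X]} (hp : p.coeff 0 ≠ 0) :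
    p.reverse.reverse = p := by
  have h : ∀ q : F[X], q.natTrailingDegree = 0 → q.mirror = q.reverse := fun q hq => by
    rw [mirror, hq, pow_zero, mul_one]
  rw [← h _ (natTrailingDegree_reverse p), ← h p (natTrailingDegree_eq_zero.mpr (Or.inr hp)),
    mirror_mirror]

/-- Cancelling f in f f* ∣ h f gives f* ∣ h, and reversing gives f ∣ h*. The shifts of h* span the
dual, by the same gap in the coefficients of (x^n - 1) m as in the skew case. -/
theorem dualCode_le_of_isGeneratedBy {n : ℕ} {C : Submodule F (Fin n → F)} {f h : F[X]}
    (hC : IsGeneratedBy C f) (hf : X ^ n - 1 = h * f) (hff : f * f.reverse ∣ X ^ n - 1) :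
    dualCode C ≤ C := by
  rcases Nat.eq_zero_or_pos n with rfl | hn
  · intro z _
    rw [Subsingleton.elim z 0]
    exact C.zero_mem
  have hdvd : f ∣ X ^ n - 1 := ⟨h, by rw [hf, mul_comm]⟩
  have hne : (X ^ n - 1 : F[X]) ≠ 0 := X_pow_sub_C_ne_zero hn 1
  have hh : h ≠ 0 := fun h0 => hne (by rw [hf, h0, zero_mul])
  have hf0 : f ≠ 0 := fun h0 => hne (by rw [hf, h0, mul_zero])
  have hdeg : h.natDegree + f.natDegree = n := by
    rw [← natDegree_mul hh hf0, ← hf]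
    exact natDegree_X_pow_sub_C (r := (1 : F))
  have hfc : f.coeff 0 ≠ 0 := fun h0 => by
    have := congrArg (fun p : F[X] => p.coeff 0) hf
    simp [mul_coeff_zero, h0, coeff_X_pow, hn.ne] at this
  have hdr : f ∣ h.reverse := by
    rw [hf, mul_comm h] at hff
    obtain ⟨t, ht⟩ := (mul_dvd_mul_iff_left hf0).mp hff
    rw [ht, reverse_mul_of_domain, reverse_reverse_of_coeff_zero_ne_zero hfc]
    exact dvd_mul_right _ _
  have hhr : h.reverse ≠ 0 := fun h0 => hh (reverse_eq_zero.mp h0)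
  have hdh := h.reverse_natDegree_le
  refine dualCode_le_of_range_le (r := h.natDegree) (s := f.natDegree)
    (A := genMatrix f _ n) (B := genMatrix h.reverse _ n) hdeg.ge
    (vecMulLinear_genMatrix_injective hf0 (by omega))
    (vecMulLinear_genMatrix_injective hhr (by omega))
    (fun m => (hC.mem_iff hdvd _).mpr ?_) (fun m => (hC.mem_iff hdvd _).mpr ?_) fun c hc j => ?_
  · rw [polyOf_vecMul_genMatrix hf0 (by omega)]
    exact dvd_mul_left _ _
  · rw [polyOf_vecMul_genMatrix hhr (by omega)]
    exact hdr.mul_left _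
  · rw [genMatrix_reverse_dotProduct]
    obtain ⟨m, hm⟩ := (hC.mem_iff hdvd c).mp hc
    by_cases hm0 : m = 0
    · rw [hm, hm0, mul_zero, zero_mul, coeff_zero]
    · have hlt : m.natDegree < h.natDegree := by
        have h1 := natDegree_mul hf0 hm0
        have h2 := degree_polyOf_lt c
        rw [hm, ← natDegree_lt_iff_degree_lt (mul_ne_zero hf0 hm0)] at h2
        omega
      have hj := j.2
      rw [hm, mul_right_comm, mul_comm f h, ← hf, sub_mul, one_mul, coeff_sub, coeff_X_pow_mul',
        if_neg (by omega), coeff_eq_zero_of_natDegree_lt (by omega), sub_zero]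

end Cyclic

/-! ### The Gray image -/

section Gray

variable {F : Type*} [Field F]

theorem pow_eq_one_of_orderOf_thetaR_dvd {Θ : RingAut F} {n : ℕ}
    (h : orderOf (thetaR Θ) ∣ n) : Θ ^ n = 1 := by
  have key : ∀ (k : ℕ) (r : RRing F), ((thetaR Θ ^ k : RingAut (RRing F)) r).re =
      (Θ ^ k : RingAut F) r.re := by
    intro k
    induction k with
    | zero => exact fun r => rfl
    | succ k ih =>
      intro r
      rw [pow_succ, pow_succ, RingAut.mul_apply, RingAut.mul_apply, ih]
      rfl
  ext a
  have := key n ⟨a, 0⟩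
  rw [orderOf_dvd_iff_pow_eq_one.mp h] at this
  exact this.symm

theorem mem_of_components {n : ℕ} {D : Submodule (RRing F) (Fin n → RRing F)}
    {r : Fin n → RRing F} (h1 : (fun i => (r i).re) ∈ component₁ D)
    (h2 : (fun i => (r i).re + (r i).im) ∈ component₂ D) : r ∈ D := by
  obtain ⟨c, hc, hcr⟩ := h1
  obtain ⟨d, hd, hdr⟩ := h2
  -- The scalars are the orthogonal idempotents 1 - u and u, which project onto the two components.
  have h : r = (⟨1, -1⟩ : RRing F) • c + (⟨0, 1⟩ : RRing F) • d := by
    ext i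
    · simpa using congrFun hcr i
    · have e1 := congrFun hcr i
      have e2 := congrFun hdr i
      beta_reduce at e1 e2
      simp [← e1, ← e2]
  rw [h]
  exact D.add_mem (D.smul_mem _ hc) (D.smul_mem _ hd)

/-- Right multiplication by M scales the dot product on F² by γ. -/
theorem grayMap_dotProduct {α β : ℕ} {M : Matrix (Fin 2) (Fin 2) F} {γ : F}
    (hM : M * Mᵀ = γ • (1 : Matrix (Fin 2) (Fin 2) F)) (c d : (Fin α → F) × (Fin β → RRing F)) :
    grayMap M α β c ⬝ᵥ grayMap M α β d = c.1 ⬝ᵥ d.1 +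
      γ * ((fun i => (c.2 i).re) ⬝ᵥ (fun i => (d.2 i).re) +
        (fun i => (c.2 i).re + (c.2 i).im) ⬝ᵥ (fun i => (d.2 i).re + (d.2 i).im)) := by
  have key : ∀ x y : Fin 2 → F, (x ᵥ* M) ⬝ᵥ (y ᵥ* M) = γ * (x ⬝ᵥ y) := fun x y => by
    rw [← Matrix.dotProduct_mulVec, ← Matrix.vecMul_transpose, Matrix.vecMul_vecMul, hM,
      Matrix.vecMul_smul, Matrix.vecMul_one, dotProduct_smul, smul_eq_mul]
  simp only [dotProduct, Fintype.sum_sum_type, Fintype.sum_prod_type] at key ⊢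
  rw [← Finset.sum_add_distrib, Finset.mul_sum]
  congr 1
  refine Finset.sum_congr rfl fun j _ => ?_
  refine (key _ _).trans ?_
  simp [Fin.sum_univ_two]

theorem grayMap_surjective {α β : ℕ} {M : Matrix (Fin 2) (Fin 2) F} {γ : F} (hγ : γ ≠ 0)
    (hM : M * Mᵀ = γ • (1 : Matrix (Fin 2) (Fin 2) F)) :
    Function.Surjective (grayMap M α β) := by
  have hM' : (γ⁻¹ • Mᵀ) * M = 1 := by
    refine mul_eq_one_comm.mp ?_
    rw [Matrix.mul_smul, hM, smul_smul, inv_mul_cancel₀ hγ, one_smul]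
  intro y
  set z : Fin β → Fin 2 → F := fun j => (fun k => y (Sum.inr (j, k))) ᵥ* (γ⁻¹ • Mᵀ) with hz
  refine ⟨(fun i => y (Sum.inl i), fun j => ⟨z j 0, z j 1 - z j 0⟩), ?_⟩
  ext (i | ⟨j, k⟩)
  · rfl
  · have h : ![z j 0, z j 0 + (z j 1 - z j 0)] = z j := by
      ext k
      fin_cases k <;> simp
    change (![z j 0, z j 0 + (z j 1 - z j 0)] ᵥ* M) k = _
    rw [h, hz, Matrix.vecMul_vecMul, hM', Matrix.vecMul_one]

/-- By surjectivity any word of the dual is a Gray image. Testing it against (c, 0), (0, (1 - u)s)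
and (0, us) separates the three component codes, with γ ≠ 0 cancelled in the last two. -/
theorem dualCode_map_grayMap_le {α β : ℕ} {M : Matrix (Fin 2) (Fin 2) F} {γ : F} (hγ : γ ≠ 0)
    (hM : M * Mᵀ = γ • (1 : Matrix (Fin 2) (Fin 2) F)) {C' : Submodule F (Fin α → F)}
    {D : Submodule (RRing F) (Fin β → RRing F)} (hC' : dualCode C' ≤ C')
    (h1 : dualCode (component₁ D) ≤ component₁ D) (h2 : dualCode (component₂ D) ≤ component₂ D) :
    dualCode ((mixedProd C' D).map (grayMap M α β)) ≤ (mixedProd C' D).map (grayMap M α β) := by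
  intro y hy
  obtain ⟨⟨a, r⟩, rfl⟩ := grayMap_surjective hγ hM y
  have hort : ∀ c ∈ C', ∀ s ∈ D, grayMap M α β (a, r) ⬝ᵥ grayMap M α β (c, s) = 0 :=
    fun c hc s hs => hy _ ⟨(c, s), ⟨hc, hs⟩, rfl⟩
  simp only [grayMap_dotProduct hM] at hort
  refine ⟨(a, r), ⟨hC' fun c hc => ?_, mem_of_components (h1 ?_) (h2 ?_)⟩, rfl⟩
  · simpa [dotProduct] using hort c hc 0 D.zero_mem
  · rintro _ ⟨s, hs, rfl⟩
    have := hort 0 C'.zero_mem _ (D.smul_mem (⟨1, -1⟩ : RRing F) hs)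
    simpa [hγ, dotProduct] using this
  · rintro _ ⟨s, hs, rfl⟩
    have := hort 0 C'.zero_mem _ (D.smul_mem (⟨0, 1⟩ : RRing F) hs)
    simpa [hγ, dotProduct] using this

end Gray

/-! ### Invariance under relabelling the coordinates -/

section Reindex

theorem hammingDist_comp_equiv {A ι κ : Type*} [DecidableEq A] [Fintype ι]
    [Fintype κ] (e : κ ≃ ι) (x y : ι → A) : hammingDist (x ∘ e) (y ∘ e) = hammingDist x y :=
  Finset.card_equiv e (by simp)

variable {F : Type*} [Field F] {ι : Type*} [Fintype ι]

theorem dualCode_map_funCongrLeft_le {κ : Type*} [Fintype κ] (e : κ ≃ ι)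
    {C : Submodule F (ι → F)} (hC : dualCode C ≤ C) :
    dualCode (C.map (LinearEquiv.funCongrLeft F F e : (ι → F) →ₗ[F] (κ → F))) ≤
      C.map (LinearEquiv.funCongrLeft F F e : (ι → F) →ₗ[F] (κ → F)) := by
  intro z hz
  refine ⟨z ∘ e.symm, hC fun c hc => ?_,
    by ext i; simp [LinearEquiv.funCongrLeft_apply, LinearMap.funLeft_apply]⟩
  rw [← hz _ ⟨c, hc, rfl⟩]
  simp only [dotProduct]
  rw [← Equiv.sum_comp e]
  simp [LinearEquiv.funCongrLeft_apply, LinearMap.funLeft_apply]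

theorem minHammingDist_map_funCongrLeft [DecidableEq F] {κ : Type*} [Fintype κ] (e : κ ≃ ι)
    (C : Submodule F (ι → F)) :
    minHammingDist (C.map (LinearEquiv.funCongrLeft F F e : (ι → F) →ₗ[F] (κ → F))) =
      minHammingDist C := by
  have hinj := (LinearEquiv.funCongrLeft F F e).injective
  unfold minHammingDist
  congr 1
  ext d
  constructor
  · rintro ⟨_, ⟨c, hc, rfl⟩, _, ⟨c', hc', rfl⟩, hne, rfl⟩
    exact ⟨c, hc, c', hc', fun h => hne (by rw [h]), (hammingDist_comp_equiv e c c').symm⟩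
  · rintro ⟨c, hc, c', hc', hne, rfl⟩
    exact ⟨_, ⟨c, hc, rfl⟩, _, ⟨c', hc', rfl⟩, fun h => hne (hinj h),
      hammingDist_comp_equiv e c c'⟩

theorem exists_isQuantumCode_of_dualCode_le_of_card [Fintype F] [DecidableEq F] {n : ℕ}
    (hι : Fintype.card ι = n) {C : Submodule F (ι → F)} (hC : dualCode C ≤ C) (hn : 0 < n) :
    n ≤ 2 * Module.finrank F C ∧ ∃ Q : Submodule ℂ (QuditSpace (Fintype.card F) n),
      IsQuantumCode (Fintype.card F) n (2 * Module.finrank F C - n) (minHammingDist C) Q := by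
  have e : Fin n ≃ ι := (Fintype.equivFinOfCardEq hι).symm
  have h := exists_isQuantumCode_of_dualCode_le (dualCode_map_funCongrLeft_le e hC) hn
  rwa [LinearEquiv.finrank_map_eq, minHammingDist_map_funCongrLeft] at h

end Reindex

end SkewQuantum

end

/-! ### The quantum code of the Gray image -/

theorem mainTheorem11 {F : Type*} [Field F] [Fintype F] [DecidableEq F]
    (Θ : RingAut F) (α β : ℕ) (hn : 0 < α + 2 * β)
    (hβ : orderOf (SkewQuantum.thetaR Θ) ∣ β)
    (hα : Nat.gcd α (orderOf Θ) = 1)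
    (M : Matrix (Fin 2) (Fin 2) F) (γ : F) (hγ : γ ≠ 0)
    (hM : M * M.transpose = γ • (1 : Matrix (Fin 2) (Fin 2) F))
    (C' : Submodule F (Fin α → F)) (hC' : SkewQuantum.IsCyclicCode C')
    (f h : Polynomial F) (hf : SkewQuantum.IsGeneratedBy C' f)
    (hhf : (Polynomial.X ^ α - 1 : Polynomial F) = h * f)
    (D : Submodule (SkewQuantum.RRing F) (Fin β → SkewQuantum.RRing F))
    (hD : SkewQuantum.IsSkewCyclic (SkewQuantum.thetaR Θ) D)
    (g₁ g₂ h₁ h₂ : SkewQuantum.SkewPoly Θ)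
    (hg₁ : SkewQuantum.IsSkewGeneratedBy Θ (SkewQuantum.component₁ D) g₁)
    (hg₂ : SkewQuantum.IsSkewGeneratedBy Θ (SkewQuantum.component₂ D) g₂)
    (hhg₁ : SkewQuantum.xPowSubOne Θ β = h₁ * g₁)
    (hhg₂ : SkewQuantum.xPowSubOne Θ β = h₂ * g₂)
    (hff : f * f.reverse ∣ (Polynomial.X ^ α - 1 : Polynomial F))
    (hd₁ : SkewQuantum.RightDvd (SkewQuantum.xPowSubOne Θ β) (SkewQuantum.dagger h₁ * h₁))
    (hd₂ : SkewQuantum.RightDvd (SkewQuantum.xPowSubOne Θ β) (SkewQuantum.dagger h₂ * h₂))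
    (k : ℕ)
    (hk : k = Module.finrank F
      ((SkewQuantum.mixedProd C' D).map (SkewQuantum.grayMap M α β))) :
    α + 2 * β ≤ 2 * k ∧
    ∃ Q : Submodule ℂ (SkewQuantum.QuditSpace (Fintype.card F) (α + 2 * β)),
      SkewQuantum.IsQuantumCode (Fintype.card F) (α + 2 * β) (2 * k - (α + 2 * β))
        (SkewQuantum.minHammingDist
          ((SkewQuantum.mixedProd C' D).map (SkewQuantum.grayMap M α β))) Q := by
  have hΘ := SkewQuantum.pow_eq_one_of_orderOf_thetaR_dvd hβ
  subst hk
  refine SkewQuantum.exists_isQuantumCode_of_dualCode_le_of_card ?_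
    (SkewQuantum.dualCode_map_grayMap_le hγ hM (SkewQuantum.dualCode_le_of_isGeneratedBy hf hhf hff)
      (SkewQuantum.dualCode_le_of_isSkewGeneratedBy hΘ hg₁ hhg₁ hd₁)
      (SkewQuantum.dualCode_le_of_isSkewGeneratedBy hΘ hg₂ hhg₂ hd₂)) hn
  rw [Fintype.card_sum, Fintype.card_prod, Fintype.card_fin, Fintype.card_fin, Fintype.card_fin,
    mul_comm]
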